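/- All groups are finite. For subgroups $A,B$ of a group, $A$ permutes with $B$ if $AB=BA$. A subgroup $H$ of a group $X$ is S-permutable in $X$ if $H$ permutes with every Sylow subgroup of $X$; it is SS-permutable (respectively, NSS-permutable) in $X$ if there is a subgroup (respectively, a normal subgroup) $S$ of $X$ with $X=HS$ such that $H$ permutes with every Sylow subgroup of $S$. A group $G$ is a PST-group if S-permutability is transitive in $G$: whenever $H\le K\le G$, $H$ is S-permutable in $K$ and $K$ is S-permutable in $G$, then $H$ is S-permutable in $G$. **Theorem C.** Let $G$ be a finite group. Then the following statements are equivalent: 1. For every prime $p$ dividing $|G|$ and all $p$-subgroups $H\le K$ of $G$, $H$ is SS-permutable in the normalizer $N_G(K)$. 2. For every prime $p$ dividing $|G|$ and all $p$-subgroups $H\le K$ of $G$, $H$ is NSS-permutable in $N_G(K)$. 3. $G$ is a solvable PST-group. -/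

import Mathlib

open scoped Pointwise

/-- `H` permutes with `K`: `HK = KH` as sets of products. -/
def Subgroup.PermutesWith {G : Type*} [Group G] (H K : Subgroup G) : Prop :=
  (H : Set G) * (K : Set G) = (K : Set G) * (H : Set G)

/-- `H` permutes with every Sylow subgroup (for every prime) of the subgroup `K`. A Sylow subgroup
of `K` is a subgroup of the group `↥K`; `Subgroup.map K.subtype` regards it as a subgroup of `G`. -/
def Subgroup.PermutesWithSylowsOf {G : Type*} [Group G] (H K : Subgroup G) : Prop :=
  ∀ p : ℕ, p.Prime → ∀ P : Sylow p K, H.PermutesWith ((P : Subgroup K).map K.subtype)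

/-- `H` is S-permutable in the whole group `G`: it permutes with every Sylow subgroup of `G`. -/
def Subgroup.IsSPermutable {G : Type*} [Group G] (H : Subgroup G) : Prop :=
  ∀ p : ℕ, p.Prime → ∀ P : Sylow p G, H.PermutesWith (P : Subgroup G)

/-- `K` is a supplement of `H` in the whole group `G`: `G = HK`. -/
def Subgroup.IsSupplement {G : Type*} [Group G] (H K : Subgroup G) : Prop :=
  (H : Set G) * (K : Set G) = Set.univ

/-- `H` is SS-permutable in the whole group `G`. -/
def Subgroup.IsSSPermutable {G : Type*} [Group G] (H : Subgroup G) : Prop :=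
  ∃ K : Subgroup G, H.IsSupplement K ∧ H.PermutesWithSylowsOf K

/-- `H` is NSS-permutable in the whole group `G`. -/
def Subgroup.IsNSSPermutable {G : Type*} [Group G] (H : Subgroup G) : Prop :=
  ∃ K : Subgroup G, K.Normal ∧ H.IsSupplement K ∧ H.PermutesWithSylowsOf K

/-- `G` is a PST-group: S-permutability is transitive in `G`. For `H ≤ K`, the subgroup `H`
regarded as a subgroup of the group `↥K` is `H.subgroupOf K`. -/
def IsPSTGroup (G : Type*) [Group G] : Prop :=
  ∀ H K : Subgroup G, H ≤ K → (H.subgroupOf K).IsSPermutable → K.IsSPermutable → H.IsSPermutable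

/-!
If a subgroup `H` of a normal `p`-subgroup is SS-permutable, then every element of order prime to
`p` normalizes `H`. Hence condition (1) says that an element of order prime to `p` normalizing a
`p`-subgroup `K` normalizes all subgroups of `K`, that is, induces a power automorphism on `K`. A
nontrivial power automorphism of order prime to `p` exists only if `K` is abelian, and then
`K = [K, x]`.

For the smallest prime divisor `p` of the order there is no such automorphism, so fusion in a Sylow
`p`-subgroup is controlled by that subgroup and the focal subgroup theorem makes the group
imperfect; as the condition passes to subgroups, `G` is solvable. By Frattini's argument the
elements of order prime to `p` also act by power automorphisms on normal `p`-subgroups of the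
quotients of `G`, and induction over a minimal normal subgroup gives, for each prime `p`, a normal
`p`-complement or an abelian Sylow `p`-subgroup all of whose subgroups are normal in `G`. The
intersection `L` of those complements is an abelian Hall subgroup on which `G` acts by power
automorphisms, and `G ⧸ L` is nilpotent. This structure (Agrawal) implies both the PST property and
the local condition.

In a PST-group subnormal subgroups are S-permutable, so the action on normal `p`-subgroups of
quotients is again by power automorphisms, and for solvable `G` the same induction applies.
-/

open Subgroup
open scoped commutatorElement

universe u

section PrimePower

variable {G : Type*} [Group G]

theorem mem_of_pow_mem_of_coprime {S : Subgroup G} {x : G} {m n : ℕ} (hmn : m.Coprime n)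
    (hm : x ^ m ∈ S) (hn : x ^ n ∈ S) : x ∈ S := by
  have bezout : x = (x ^ m) ^ m.gcdA n * (x ^ n) ^ m.gcdB n := by
    rw [← zpow_natCast, ← zpow_natCast, ← zpow_mul, ← zpow_mul, ← zpow_add,
      ← Nat.gcd_eq_gcd_ab, hmn.gcd_eq_one, Nat.cast_one, zpow_one]
  rw [bezout]
  exact S.mul_mem (S.zpow_mem hm _) (S.zpow_mem hn _)

theorem le_of_forall_prime_pow_orderOf [Finite G] {H S : Subgroup G}
    (h : ∀ q k : ℕ, q.Prime → ∀ y ∈ H, orderOf y = q ^ (k + 1) → y ∈ S) : H ≤ S := by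
  suffices ∀ n : ℕ, ∀ y ∈ H, orderOf y = n → y ∈ S from fun y hy => this _ y hy rfl
  intro n
  induction n using Nat.recOnPosPrimePosCoprime with
  | zero => exact fun y _ hy => absurd hy (orderOf_pos y).ne'
  | one => exact fun y _ hy => orderOf_eq_one_iff.mp hy ▸ S.one_mem
  | prime_pow p k hp hk =>
    obtain ⟨k, rfl⟩ := Nat.exists_eq_add_one.mpr hk
    exact h p k hp
  | coprime a b ha hb hab iha ihb =>
    intro y hyH hy
    refine mem_of_pow_mem_of_coprime hab (ihb _ (pow_mem hyH a) ?_) (iha _ (pow_mem hyH b) ?_)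
    · rw [orderOf_pow_of_dvd (by lia) (hy ▸ Dvd.intro _ rfl), hy,
        Nat.mul_div_cancel_left _ (by lia)]
    · rw [orderOf_pow_of_dvd (by lia) (hy ▸ Dvd.intro_left _ rfl), hy,
        Nat.mul_div_cancel _ (by lia)]

theorem mem_of_coprime_of_forall_prime_pow_orderOf [Finite G] {S : Subgroup G} {x : G} {p : ℕ}
    (hx : (orderOf x).Coprime p)
    (h : ∀ q k : ℕ, q.Prime → q ≠ p → ∀ y ∈ zpowers x, orderOf y = q ^ (k + 1) → y ∈ S) :
    x ∈ S := by
  suffices zpowers x ≤ S from this (mem_zpowers x)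
  refine le_of_forall_prime_pow_orderOf fun q k hq y hyx hy => h q k hq ?_ y hyx hy
  rintro rfl
  have hqx : q ∣ orderOf x :=
    (Dvd.intro_left _ (hy ▸ pow_succ q k).symm).trans (orderOf_dvd_of_mem_zpowers hyx)
  exact hq.not_dvd_one (hx.gcd_eq_one ▸ Nat.dvd_gcd hqx dvd_rfl)

theorem mem_normalizer_of_forall_prime_pow_orderOf [Finite G] {H : Subgroup G} {x : G}
    (h : ∀ q k : ℕ, q.Prime → ∀ y ∈ H, orderOf y = q ^ (k + 1) → x * y * x⁻¹ ∈ H) :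
    x ∈ normalizer (H : Set G) := by
  have hconj : H ≤ H.comap (MulAut.conj x).toMonoidHom := le_of_forall_prime_pow_orderOf h
  exact mem_normalizer_fintype fun y hy => hconj hy

theorem isPGroup_zpowers_of_orderOf_eq {p k : ℕ} {x : G} (hx : orderOf x = p ^ k) :
    IsPGroup p (zpowers x) :=
  IsPGroup.of_card (n := k) (by rw [Nat.card_zpowers, hx])

theorem exists_sylow_mem_of_orderOf_eq {p k : ℕ} {x : G} (hx : orderOf x = p ^ k) :
    ∃ P : Sylow p G, x ∈ P := by
  obtain ⟨P, hP⟩ := (isPGroup_zpowers_of_orderOf_eq hx).exists_le_sylow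
  exact ⟨P, hP (mem_zpowers x)⟩

theorem coprime_orderOf_of_mem {p n : ℕ} {P : Subgroup G} (hP : IsPGroup p P) (hpn : p.Coprime n)
    {x : G} (hx : x ∈ P) : (orderOf x).Coprime n := by
  simpa only [orderOf_mk] using hP.orderOf_coprime hpn ⟨x, hx⟩

theorem mem_of_coprime_orderOf_index {N : Subgroup G} [N.Normal] {x : G}
    (h : (orderOf x).Coprime N.index) : x ∈ N := by
  rw [← QuotientGroup.eq_one_iff, ← orderOf_eq_one_iff (G := G ⧸ N)]
  refine Nat.eq_one_of_dvd_coprimes h (orderOf_map_dvd (QuotientGroup.mk' N) x) ?_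
  exact N.index_eq_card ▸ _root_.orderOf_dvd_natCard (x : G ⧸ N)

theorem eq_top_of_sylow_le_of_forall_coprime_mem [Finite G] {p : ℕ} [Fact p.Prime] (P : Sylow p G)
    {S : Subgroup G} (hP : P ≤ S) (hS : ∀ x : G, (orderOf x).Coprime p → x ∈ S) : S = ⊤ := by
  rw [← index_eq_one]
  by_contra hne
  obtain ⟨q, hq, hqS⟩ := Nat.exists_prime_and_dvd hne
  have := Fact.mk hq
  rcases eq_or_ne q p with rfl | hqp
  · exact P.not_dvd_index (hqS.trans (index_dvd_of_le hP))
  · let Q : Sylow q G := default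
    exact Q.not_dvd_index (hqS.trans (index_dvd_of_le fun x hx => hS x
      (coprime_orderOf_of_mem Q.isPGroup' ((Nat.coprime_primes hq Fact.out).mpr hqp) hx)))

end PrimePower

section PowerNormalizer

variable {G : Type*} [Group G]

/-- The subgroup of all elements normalizing every subgroup of `K`, that is, of the elements of the
normalizer of `K` which induce a power automorphism on `K`. -/
def powerNormalizer (K : Subgroup G) : Subgroup G :=
  ⨅ (H : Subgroup G) (_ : H ≤ K), normalizer (H : Set G)

variable {H K : Subgroup G} {x : G}

theorem mem_powerNormalizer :
    x ∈ powerNormalizer K ↔ ∀ H ≤ K, x ∈ normalizer (H : Set G) := by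
  simp only [powerNormalizer, mem_iInf]

theorem powerNormalizer_le_normalizer : powerNormalizer K ≤ normalizer (K : Set G) :=
  fun _ hx => mem_powerNormalizer.mp hx K le_rfl

theorem powerNormalizer_anti (hHK : H ≤ K) : powerNormalizer K ≤ powerNormalizer H :=
  fun _ hx => mem_powerNormalizer.mpr fun _ hDH => mem_powerNormalizer.mp hx _ (hDH.trans hHK)

theorem conj_mem_zpowers_of_mem_powerNormalizer (hx : x ∈ powerNormalizer K) {k : G} (hk : k ∈ K) :
    x * k * x⁻¹ ∈ zpowers k :=
  (mem_normalizer_iff.mp (mem_powerNormalizer.mp hx _ (zpowers_le.mpr hk)) k).mp (mem_zpowers k)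

theorem centralizer_le_powerNormalizer : centralizer (K : Set G) ≤ powerNormalizer K :=
  fun _ hx => mem_powerNormalizer.mpr fun _ hHK =>
    centralizer_le_normalizer _ (centralizer_le hHK hx)

theorem normal_of_powerNormalizer_eq_top (hK : powerNormalizer K = ⊤) (hHK : H ≤ K) : H.Normal :=
  normalizer_eq_top_iff.mp (top_le_iff.mp
    (hK ▸ fun _ hx => mem_powerNormalizer.mp hx H hHK))

theorem map_powerNormalizer_le {G' : Type*} [Group G'] (f : G →* G') :
    (powerNormalizer K).map f ≤ powerNormalizer (K.map f) := by
  rintro _ ⟨x, hx, rfl⟩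
  refine mem_powerNormalizer.mpr fun H hH => ?_
  have hmap : (K ⊓ H.comap f).map f = H := by
    rw [← SetLike.coe_set_eq, coe_map, coe_inf, coe_comap, Set.image_inter_preimage, ← coe_map]
    exact Set.inter_eq_right.mpr hH
  rw [← hmap]
  exact le_normalizer_map f (mem_map_of_mem f (mem_powerNormalizer.mp hx _ inf_le_left))

theorem comap_powerNormalizer_map_le {G' : Type*} [Group G'] {f : G →* G'}
    (hf : Function.Injective f) : (powerNormalizer (K.map f)).comap f ≤ powerNormalizer K := by
  refine fun x hx => mem_powerNormalizer.mpr fun H hH => ?_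
  have := mem_powerNormalizer.mp hx (H.map f) (map_mono hH)
  rw [← comap_map_eq_self_of_injective hf H]
  exact le_normalizer_comap f this

end PowerNormalizer

section Permute

variable {G : Type*} [Group G] {H K Q : Subgroup G}

theorem coe_sup_of_permutesWith (h : H.PermutesWith K) :
    ((H ⊔ K : Subgroup G) : Set G) = H * K := by
  let HK : Subgroup G :=
    { carrier := H * K
      mul_mem' := by
        intro a b ha hb
        have hab : a * b ∈ ((H : Set G) * K) * (H * K) := Set.mul_mem_mul ha hb
        rwa [mul_assoc, ← mul_assoc (K : Set G), ← show (H : Set G) * K = K * H from h, mul_assoc,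
          coe_mul_coe, ← mul_assoc, coe_mul_coe] at hab
      one_mem' := ⟨1, H.one_mem, 1, K.one_mem, mul_one 1⟩
      inv_mem' := by
        rintro _ ⟨a, ha, b, hb, rfl⟩
        rw [show (H : Set G) * K = K * H from h]
        exact ⟨b⁻¹, K.inv_mem hb, a⁻¹, H.inv_mem ha, (mul_inv_rev a b).symm⟩ }
  refine Set.Subset.antisymm (?_ : H ⊔ K ≤ HK) ?_
  · exact sup_le (fun x hx => ⟨x, hx, 1, K.one_mem, mul_one x⟩)
      (fun x hx => ⟨1, H.one_mem, x, hx, one_mul x⟩)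
  · rintro _ ⟨a, ha, b, hb, rfl⟩
    exact mul_mem_sup ha hb

theorem permutesWith_of_forall_mul_mem (h : ∀ x ∈ K, ∀ y ∈ H, x * y ∈ (H : Set G) * K) :
    H.PermutesWith K := by
  have hKH : (K : Set G) * H ⊆ H * K := by
    rintro _ ⟨x, hx, y, hy, rfl⟩
    exact h x hx y hy
  refine Set.Subset.antisymm ?_ hKH
  simpa only [Set.inv_subset_inv, mul_inv_rev, inv_coe_set] using Set.inv_subset_inv.mpr hKH

theorem permutesWith_of_forall_prime_pow_orderOf [Finite G]
    (h : ∀ q k : ℕ, q.Prime → ∀ y ∈ H, orderOf y = q ^ (k + 1) →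
      ∀ x ∈ K, x * y ∈ (H : Set G) * K) : H.PermutesWith K := by
  let M : Submonoid G :=
    { carrier := {y | ∀ x ∈ K, x * y ∈ (H : Set G) * K}
      one_mem' := fun x hx => ⟨1, H.one_mem, x, hx, (one_mul x).trans (mul_one x).symm⟩
      mul_mem' := by
        intro y z hy hz x hx
        obtain ⟨a, ha, b, hb, hab : a * b = x * y⟩ := hy x hx
        obtain ⟨c, hc, d, hd, hcd : c * d = b * z⟩ := hz b hb
        refine ⟨a * c, H.mul_mem ha hc, d, hd, ?_⟩
        change a * c * d = x * (y * z)
        rw [mul_assoc, hcd, ← mul_assoc, hab, mul_assoc] }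
  let S : Subgroup G :=
    { M with
      inv_mem' := fun {y} hy => (Submonoid.powers_le (P := M)).mpr hy
        (mem_powers_iff_mem_zpowers.mpr (inv_mem (mem_zpowers y))) }
  have hHS : H ≤ S := le_of_forall_prime_pow_orderOf h
  exact permutesWith_of_forall_mul_mem fun x hx y hy => hHS hy x hx

theorem permutesWith_of_le_normalizer (h : K ≤ normalizer (H : Set G)) : H.PermutesWith K := by
  rw [PermutesWith, ← coe_mul_of_right_le_normalizer_left H K h, sup_comm,
    ← coe_mul_of_left_le_normalizer_right K H h]

theorem permutesWith_map {G' : Type*} [Group G'] (f : G →* G') (h : H.PermutesWith K) :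
    (H.map f).PermutesWith (K.map f) := by
  rw [PermutesWith, coe_map, coe_map, ← Set.image_mul, ← Set.image_mul, h]

theorem le_normalizer_of_permutesWith (hKQ : Disjoint K Q) (hQK : Q ≤ normalizer (K : Set G))
    (hHK : H ≤ K) (h : H.PermutesWith Q) : Q ≤ normalizer (H : Set G) := by
  refine le_normalizer_iff.mpr fun x hx y hy => ?_
  obtain ⟨a, ha, b, hb, hab : a * b = x * y⟩ : x * y ∈ (H : Set G) * Q := by
    rw [show (H : Set G) * Q = Q * H from h]
    exact Set.mul_mem_mul hx hy
  have hbx : b * x⁻¹ = a⁻¹ * (x * y * x⁻¹) := by rw [← hab]; group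
  have hbx_one : b * x⁻¹ = 1 := disjoint_def.mp hKQ
    (hbx ▸ K.mul_mem (K.inv_mem (hHK ha)) (le_normalizer_iff.mp hQK x hx y (hHK hy)))
    (Q.mul_mem hb (Q.inv_mem hx))
  rwa [← hab, mul_assoc, hbx_one, mul_one]

theorem relIndex_eq_index_of_isSupplement (h : H.IsSupplement K) : K.relIndex H = K.index := by
  have : MulAction.IsPretransitive H (G ⧸ K) := by
    refine (MulAction.isPretransitive_iff_base (QuotientGroup.mk (1 : G) : G ⧸ K)).mpr fun y => ?_
    obtain ⟨g, rfl⟩ := QuotientGroup.mk_surjective y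
    obtain ⟨a, ha, b, hb, rfl⟩ : g ∈ (H : Set G) * K := h ▸ Set.mem_univ g
    exact ⟨⟨a, ha⟩, QuotientGroup.eq.mpr (by simpa using hb)⟩
  have hstab : MulAction.stabilizer H (QuotientGroup.mk 1 : G ⧸ K) = K.subgroupOf H := by
    ext a
    rw [MulAction.mem_stabilizer_iff, mem_subgroupOf]
    change (QuotientGroup.mk ((a : G) * 1) : G ⧸ K) = _ ↔ _
    rw [eq_comm, QuotientGroup.eq]
    simp
  rw [relIndex, ← hstab, MulAction.index_stabilizer_of_transitive, index_eq_card]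

theorem relIndex_sup_of_permutesWith (h : H.PermutesWith K) :
    H.relIndex (H ⊔ K) = H.relIndex K := by
  have hsupp : (K.subgroupOf (H ⊔ K)).IsSupplement (H.subgroupOf (H ⊔ K)) := by
    refine Set.eq_univ_of_forall fun t => ?_
    obtain ⟨a, ha, b, hb, hab⟩ : (t : G) ∈ (K : Set G) * H := by
      rw [← show (H : Set G) * K = K * H from h, ← coe_sup_of_permutesWith h]
      exact t.2
    exact ⟨⟨a, le_sup_right (a := H) ha⟩, ha, ⟨b, le_sup_left (b := K) hb⟩, hb, Subtype.ext hab⟩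
  rw [← relIndex_subgroupOf (K := K) (L := H ⊔ K) le_sup_right,
    relIndex_eq_index_of_isSupplement hsupp, relIndex]

theorem le_of_permutesWith_of_coprime {N : Subgroup G} [N.Normal] (h : H.PermutesWith Q)
    (hN : N ≤ H ⊔ Q) (hNQ : (Nat.card N).Coprime (Nat.card Q)) : N ≤ H := by
  have hHN : H.PermutesWith N := set_mul_normal_comm (H : Set G) N
  refine relIndex_eq_one.mp (Nat.eq_one_of_dvd_coprimes hNQ (H.relIndex_dvd_card N) ?_)
  rw [← relIndex_sup_of_permutesWith hHN]
  refine (Dvd.intro _ (H.relIndex_mul_relIndex _ _ le_sup_left (sup_le le_sup_left hN))).trans ?_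
  exact relIndex_sup_of_permutesWith h ▸ H.relIndex_dvd_card Q

theorem exists_mem_sylow_eq_conj_smul_map [Finite G] {q : ℕ} [hq : Fact q.Prime]
    (h : H.IsSupplement K) (hqK : ¬ q ∣ K.index) (P : Sylow q G) :
    ∃ a ∈ H, ∃ R : Sylow q K,
      (P : Subgroup G) = MulAut.conj a • (R : Subgroup K).map K.subtype := by
  let R : Sylow q K := default
  let P₀ : Sylow q G := (R.isPGroup'.map K.subtype).toSylow (by
    rw [index_map_subtype]
    exact hq.out.not_dvd_mul R.not_dvd_index hqK)
  obtain ⟨g, rfl⟩ := MulAction.exists_smul_eq G P₀ P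
  obtain ⟨a, ha, s, hs, rfl⟩ : g ∈ (H : Set G) * K := h ▸ Set.mem_univ g
  refine ⟨a, ha, (⟨s, hs⟩ : K) • R, ?_⟩
  rw [mul_smul, Sylow.coe_subgroup_smul, Sylow.coe_subgroup_smul, Sylow.coe_subgroup_smul]
  congr 1
  change ((R : Subgroup K).map K.subtype).map (MulAut.conj s).toMonoidHom =
    ((R : Subgroup K).map (MulAut.conj (⟨s, hs⟩ : K)).toMonoidHom).map K.subtype
  rw [map_map, map_map]
  rfl

end Permute

theorem isSSPermutable_of_isNSSPermutable {G : Type*} [Group G] {H : Subgroup G}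
    (h : H.IsNSSPermutable) : H.IsSSPermutable :=
  let ⟨S, _, hS, hperm⟩ := h
  ⟨S, hS, hperm⟩

section SSPermutable

variable {G : Type*} [Group G] {p : ℕ} [hp : Fact p.Prime] {H K : Subgroup G}

theorem sylow_le_normalizer_of_isSSPermutable [Finite G] [K.Normal] (hK : IsPGroup p K)
    (hHK : H ≤ K) (h : H.IsSSPermutable) {q : ℕ} [hq : Fact q.Prime] (hqp : q ≠ p) (Q : Sylow q G) :
    Q ≤ normalizer (H : Set G) := by
  obtain ⟨S, hS, hperm⟩ := h
  have hqS : ¬ q ∣ S.index := fun hqS => by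
    rw [← relIndex_eq_index_of_isSupplement hS] at hqS
    obtain ⟨n, hn⟩ := IsPGroup.iff_card.mp (hK.to_le hHK)
    exact hqp ((Nat.prime_dvd_prime_iff_eq hq.out hp.out).mp
      (hq.out.dvd_of_dvd_pow (hn ▸ hqS.trans (S.relIndex_dvd_card H))))
  obtain ⟨a, ha, R, hQ⟩ := exists_mem_sylow_eq_conj_smul_map hS hqS Q
  have hR : (R : Subgroup S).map S.subtype ≤ normalizer (H : Set G) :=
    le_normalizer_of_permutesWith (IsPGroup.disjoint_of_ne p q hqp.symm K _ hK (R.2.map _))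
      le_normalizer_of_normal hHK (hperm q hq.out R)
  exact hQ ▸ conj_smul_le_of_le hR ⟨a, le_normalizer ha⟩

theorem mem_normalizer_of_isSSPermutable [Finite G] [K.Normal] (hK : IsPGroup p K) (hHK : H ≤ K)
    (h : H.IsSSPermutable) {x : G} (hx : (orderOf x).Coprime p) : x ∈ normalizer (H : Set G) := by
  refine mem_of_coprime_of_forall_prime_pow_orderOf hx fun q k hq hqp y _ hy => ?_
  have := Fact.mk hq
  obtain ⟨Q, hQ⟩ := exists_sylow_mem_of_orderOf_eq hy
  exact sylow_le_normalizer_of_isSSPermutable hK hHK h hqp Q hQ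

theorem isNSSPermutable_of_forall_mem_normalizer [K.Normal] (hK : IsPGroup p K) (hHK : H ≤ K)
    (h : ∀ x : G, (orderOf x).Coprime p → x ∈ normalizer (H : Set G)) : H.IsNSSPermutable := by
  refine ⟨⊤, inferInstance, Set.eq_univ_of_forall fun x => ⟨1, H.one_mem, x, mem_top x, one_mul x⟩,
    fun q hq P => ?_⟩
  rcases eq_or_ne q p with rfl | hqp
  · have hKP : K.subgroupOf ⊤ ≤ P := hK.comap_subtype.le_sylow_of_normal P
    have hHP : H ≤ (P : Subgroup (⊤ : Subgroup G)).map (⊤ : Subgroup G).subtype :=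
      hHK.trans ((map_subgroupOf_eq_of_le le_top).ge.trans (map_mono hKP))
    exact (permutesWith_of_le_normalizer (hHP.trans le_normalizer)).symm
  · exact permutesWith_of_le_normalizer fun x hx => h x (coprime_orderOf_of_mem
      (P.isPGroup'.map _) ((Nat.coprime_primes hq hp.out).mpr hqp) hx)

end SSPermutable

section PowerAutomorphism

variable {P : Type*} [Group P] {p : ℕ} {φ : MulAut P} {k l : P} {i m : ℤ}

theorem pow_apply_eq_zpow_pow (h : φ k = k ^ m) (j : ℕ) : (φ ^ j) k = k ^ (m ^ j) := by
  induction j with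
  | zero => rw [pow_zero, MulAut.one_apply, pow_zero, zpow_one]
  | succ j ih => rw [pow_succ', MulAut.mul_apply, ih, map_zpow, h, ← zpow_mul, pow_succ']

theorem apply_eq_self_of_dvd_sub_one (hP : IsPGroup p P) (hφ : (orderOf φ).Coprime p)
    (h : φ k = k ^ m) (hm : (p : ℤ) ∣ m - 1) : φ k = k := by
  obtain ⟨e, he⟩ := hP k
  have hfix : φ ^ p ^ e ∈ MulAction.stabilizer (MulAut P) k := by
    have hd : (p : ℤ) ^ e ∣ m ^ p ^ e - 1 := by
      simpa only [one_pow] using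
        (pow_dvd_pow (p : ℤ) e.le_succ).trans (dvd_sub_pow_of_dvd_sub hm e)
    have hk : k ^ (m ^ p ^ e - 1) = 1 := by
      obtain ⟨c, hc⟩ := hd
      rw [hc, zpow_mul, ← Nat.cast_pow, zpow_natCast, he, one_zpow]
    rwa [MulAction.mem_stabilizer_iff, MulAut.smul_def, pow_apply_eq_zpow_pow h, ← mul_inv_eq_one,
      ← zpow_sub_one]
  exact mem_of_pow_mem_of_coprime (hφ.pow_right e) (pow_orderOf_eq_one φ ▸ one_mem _) hfix

variable [hp : Fact p.Prime]

theorem dvd_of_zpow_eq_one (hP : IsPGroup p P) (hk : k ≠ 1) (h : k ^ m = 1) : (p : ℤ) ∣ m :=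
  (Int.natCast_dvd_natCast.mpr (hP.dvd_orderOf hk)).trans (orderOf_dvd_iff_zpow_eq_one.mpr h)

theorem mem_zpowers_zpow_of_not_dvd (hP : IsPGroup p P) (k : P) (hm : ¬ (p : ℤ) ∣ m) :
    k ∈ zpowers (k ^ m) := by
  obtain ⟨e, he⟩ := hP k
  obtain ⟨u, v, huv⟩ : IsCoprime m ((p : ℤ) ^ e) :=
    ((Nat.prime_iff_prime_int.mp hp.out).coprime_iff_not_dvd.mpr hm).symm.pow_right
  refine mem_zpowers_iff.mpr ⟨u, ?_⟩
  have hk : k ^ (v * (p : ℤ) ^ e) = 1 := by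
    rw [mul_comm, zpow_mul, ← Nat.cast_pow, zpow_natCast, he, one_zpow]
  rw [← zpow_mul, mul_comm, ← mul_one (k ^ (u * m)), ← hk, ← zpow_add, huv, zpow_one]

theorem not_dvd_of_apply_eq_zpow (hP : IsPGroup p P) (hk : k ≠ 1) (h : φ k = k ^ m) :
    ¬ (p : ℤ) ∣ m := by
  rintro ⟨c, rfl⟩
  obtain ⟨e, he⟩ := IsPGroup.iff_orderOf.mp hP k
  obtain _ | e := e
  · exact hk (orderOf_eq_one_iff.mp (by rwa [pow_zero] at he))
  have hke : k ^ p ^ e = 1 := φ.injective <| by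
    rw [map_one, map_pow, h, ← zpow_natCast, ← zpow_mul, mul_right_comm, ← Nat.cast_mul,
      ← pow_succ', ← he, zpow_mul, zpow_natCast, pow_orderOf_eq_one, one_zpow]
  have hdvd : p ^ (e + 1) ∣ p ^ e := he ▸ orderOf_dvd_of_pow_eq_one hke
  exact (Nat.lt_succ_self e).not_ge ((Nat.pow_dvd_pow_iff_le_right hp.out.one_lt).mp hdvd)

theorem dvd_sub_of_commute (hP : IsPGroup p P) (hφ : ∀ k, φ k ∈ zpowers k) (hk : k ≠ 1)
    (hl : l ≠ 1) (hkl : Commute k l) (hm : φ k = k ^ m) (hi : φ l = l ^ i) : (p : ℤ) ∣ m - i := by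
  by_cases hd : Disjoint (zpowers k) (zpowers l)
  · obtain ⟨s, hs⟩ := mem_zpowers_iff.mp (hφ (k * l))
    have e : k ^ (m - s) = l ^ (s - i) := by
      rw [map_mul, hm, hi, hkl.mul_zpow] at hs
      rw [← neg_add_eq_sub, zpow_add, zpow_neg, zpow_sub, inv_mul_eq_iff_eq_mul, ← mul_assoc,
        eq_mul_inv_iff_mul_eq, hs]
    have hk1 : k ^ (m - s) = 1 :=
      disjoint_def.mp hd (zpow_mem_zpowers k _) (e ▸ zpow_mem_zpowers l _)
    rw [← sub_add_sub_cancel m s i]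
    exact dvd_add (dvd_of_zpow_eq_one hP hk hk1) (dvd_of_zpow_eq_one hP hl (e ▸ hk1))
  · rw [disjoint_def] at hd
    push Not at hd
    obtain ⟨y, hyk, hyl, hy⟩ := hd
    obtain ⟨a, rfl⟩ := mem_zpowers_iff.mp hyk
    obtain ⟨b, hb⟩ := mem_zpowers_iff.mp hyl
    have hφm : φ (k ^ a) = (k ^ a) ^ m := by rw [map_zpow, hm, ← zpow_mul, ← zpow_mul, mul_comm]
    have hφi : φ (k ^ a) = (k ^ a) ^ i := by
      rw [← hb, map_zpow, hi, ← zpow_mul, ← zpow_mul, mul_comm]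
    refine dvd_of_zpow_eq_one hP hy ?_
    rw [zpow_sub, ← hφm, hφi, mul_inv_cancel]

theorem exists_uniform_exponent [Finite P] [Nontrivial P] (hP : IsPGroup p P)
    (hφ : ∀ k, φ k ∈ zpowers k) :
    ∃ i : ℤ, ¬ (p : ℤ) ∣ i ∧ ∀ k : P, k ≠ 1 → ∀ m : ℤ, φ k = k ^ m → (p : ℤ) ∣ m - i := by
  have := hP.center_nontrivial
  obtain ⟨⟨z, hz⟩, hz1⟩ := exists_ne (1 : center P)
  have hz1 : z ≠ 1 := fun h => hz1 (Subtype.ext h)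
  obtain ⟨i, hi⟩ := mem_zpowers_iff.mp (hφ z)
  exact ⟨i, not_dvd_of_apply_eq_zpow hP hz1 hi.symm, fun k hk m hm =>
    dvd_sub_of_commute hP hφ hk hz1 (mem_center_iff.mp hz k) hm hi.symm⟩

omit hp in
theorem commutatorElement_zpow_zpow {g h : P} (hc : ⁅g, h⁆ ∈ center P) (k m : ℤ) :
    ⁅g ^ k, h ^ m⁆ = ⁅g, h⁆ ^ (k * m) := by
  have hcomm (x : P) : Commute ⁅g, h⁆ x := (mem_center_iff.mp hc x).symm
  have hconj : h * g⁻¹ * h⁻¹ = g⁻¹ * ⁅g, h⁆ := by rw [commutatorElement_def]; group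
  have hpow : h * (g ^ k)⁻¹ * h⁻¹ = (g ^ k)⁻¹ * ⁅g, h⁆ ^ k := by
    rw [← inv_zpow, ← conj_zpow, hconj, ← (hcomm g⁻¹).symm.mul_zpow]
  have hleft : g ^ k * h * (g ^ k)⁻¹ = ⁅g, h⁆ ^ k * h := by
    rw [mul_assoc, mul_inv_eq_iff_eq_mul.mp hpow, mul_assoc, mul_inv_cancel_left]
  rw [commutatorElement_def, ← conj_zpow, hleft, ((hcomm h).zpow_left k).mul_zpow, ← zpow_mul,
    mul_inv_cancel_right]

omit hp in
theorem exists_commutatorElement_mem_center [Group.IsNilpotent P] (h : ¬ IsMulCommutative P) :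
    ∃ g x : P, ⁅g, x⁆ ∈ center P ∧ ⁅g, x⁆ ≠ 1 := by
  have hcenter : center P ≠ ⊤ := fun htop => h ⟨⟨fun a b =>
    mem_center_iff.mp (htop ▸ mem_top b : b ∈ center P) a⟩⟩
  have : Nontrivial (P ⧸ center P) := QuotientGroup.nontrivial_iff.mpr hcenter
  obtain ⟨c, hc, hc1⟩ := (bot_or_exists_ne_one (center (P ⧸ center P))).resolve_left
    (Group.IsNilpotent.center_ne_bot _)
  obtain ⟨g, rfl⟩ := QuotientGroup.mk_surjective c
  obtain ⟨x, hx⟩ : ∃ x : P, ⁅g, x⁆ ≠ 1 := by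
    by_contra! hg
    exact hc1 ((QuotientGroup.eq_one_iff g).mpr (mem_center_iff.mpr fun x =>
      (commutatorElement_eq_one_iff_mul_comm.mp (hg x)).symm))
  refine ⟨g, x, ?_, hx⟩
  rw [← QuotientGroup.eq_one_iff]
  exact commutatorElement_eq_one_iff_mul_comm.mpr (mem_center_iff.mp hc x).symm

theorem isMulCommutative_of_uniform_exponent [Finite P] (hP : IsPGroup p P)
    (hφ : ∀ k, φ k ∈ zpowers k) (hi : ∀ k : P, k ≠ 1 → ∀ m : ℤ, φ k = k ^ m → (p : ℤ) ∣ m - i)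
    (hi₀ : ¬ (p : ℤ) ∣ i) (hi₁ : ¬ (p : ℤ) ∣ i - 1) : IsMulCommutative P := by
  have := hP.isNilpotent
  by_contra hcomm
  obtain ⟨g, x, hc, hc1⟩ := exists_commutatorElement_mem_center hcomm
  have hg : g ≠ 1 := by rintro rfl; exact hc1 (commutatorElement_one_left x)
  have hx : x ≠ 1 := by rintro rfl; exact hc1 (commutatorElement_one_right g)
  obtain ⟨a, ha⟩ := mem_zpowers_iff.mp (hφ g)
  obtain ⟨b, hb⟩ := mem_zpowers_iff.mp (hφ x)
  have hab : φ ⁅g, x⁆ = ⁅g, x⁆ ^ (a * b) := by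
    rw [map_commutatorElement, ← ha, ← hb, commutatorElement_zpow_zpow hc]
  have hdvd : (p : ℤ) ∣ i * (i - 1) := by
    have : i * (i - 1) = (a * b - i) - (a - i) * b - i * (b - i) := by ring
    rw [this]
    exact dvd_sub (dvd_sub (hi _ hc1 _ hab) ((hi g hg a ha.symm).mul_right _))
      ((hi x hx b hb.symm).mul_left _)
  exact ((Nat.prime_iff_prime_int.mp hp.out).dvd_or_dvd hdvd).elim hi₀ hi₁

theorem eq_one_or_isMulCommutative_of_forall_mem_zpowers [Finite P] (hP : IsPGroup p P)
    (hφ : ∀ k, φ k ∈ zpowers k) (hφp : (orderOf φ).Coprime p) :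
    φ = 1 ∨ (IsMulCommutative P ∧ ∀ k : P, k ∈ zpowers (φ k * k⁻¹)) := by
  rcases subsingleton_or_nontrivial P with _ | _
  · exact Or.inl (MulEquiv.ext fun k => Subsingleton.elim _ _)
  obtain ⟨i, hi₀, hi⟩ := exists_uniform_exponent hP hφ
  by_cases hi₁ : (p : ℤ) ∣ i - 1
  · refine Or.inl (MulEquiv.ext fun k => ?_)
    rcases eq_or_ne k 1 with rfl | hk
    · rw [map_one, map_one]
    obtain ⟨m, hm⟩ := mem_zpowers_iff.mp (hφ k)
    refine apply_eq_self_of_dvd_sub_one hP hφp hm.symm ?_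
    rw [← sub_add_sub_cancel m i 1]
    exact dvd_add (hi k hk m hm.symm) hi₁
  · refine Or.inr ⟨isMulCommutative_of_uniform_exponent hP hφ hi hi₀ hi₁, fun k => ?_⟩
    rcases eq_or_ne k 1 with rfl | hk
    · exact one_mem _
    obtain ⟨m, hm⟩ := mem_zpowers_iff.mp (hφ k)
    rw [← hm, ← zpow_sub_one]
    refine mem_zpowers_zpow_of_not_dvd hP k fun hm₁ => hi₁ ?_
    rw [← sub_sub_sub_cancel_left 1 i m]
    exact dvd_sub hm₁ (hi k hk m hm.symm)

theorem mem_centralizer_or_isMulCommutative_of_mem_powerNormalizer {G : Type*} [Group G]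
    {K : Subgroup G} [Finite K] (hK : IsPGroup p K) {x : G} (hx : x ∈ powerNormalizer K)
    (hxp : (orderOf x).Coprime p) :
    x ∈ centralizer (K : Set G) ∨ (IsMulCommutative K ∧ ∀ k ∈ K, k ∈ zpowers ⁅x, k⁆) := by
  let x' : normalizer (K : Set G) := ⟨x, powerNormalizer_le_normalizer hx⟩
  have mem_zpowers_coe {a b : K} : a ∈ zpowers b ↔ (a : G) ∈ zpowers (b : G) := by
    simp only [mem_zpowers_iff, ← coe_zpow, Subtype.coe_inj]
  have hdvd : orderOf (K.normalizerMonoidHom x') ∣ orderOf x :=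
    (orderOf_map_dvd _ x').trans (orderOf_mk x _).dvd
  rcases eq_one_or_isMulCommutative_of_forall_mem_zpowers hK (φ := K.normalizerMonoidHom x')
    (fun k => mem_zpowers_coe.mpr (conj_mem_zpowers_of_mem_powerNormalizer hx k.2))
    (hxp.coprime_dvd_left hdvd) with hone | ⟨hcomm, hmem⟩
  · refine Or.inl (mem_centralizer_iff.mpr fun k hk => ?_)
    have hconj : x * k * x⁻¹ = k :=
      congrArg ((↑) : K → G) (DFunLike.congr_fun hone (⟨k, hk⟩ : K))
    exact (mul_inv_eq_iff_eq_mul.mp hconj).symm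
  · exact Or.inr ⟨hcomm, fun k hk => mem_zpowers_coe.mp (hmem ⟨k, hk⟩)⟩

end PowerAutomorphism

/-- Every element of order prime to `p` which normalizes a `p`-subgroup induces a power automorphism
on it. -/
def HasLocalPowerAction (G : Type*) [Group G] : Prop :=
  ∀ p : ℕ, p.Prime → ∀ K : Subgroup G, IsPGroup p K → ∀ x ∈ normalizer (K : Set G),
    (orderOf x).Coprime p → x ∈ powerNormalizer K

/-- `L` is an abelian Hall subgroup on which `G` acts by conjugation as a group of power
automorphisms and for which `G ⧸ L` is nilpotent. By a theorem of Agrawal, a finite group with such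
a subgroup is a solvable PST-group. Nilpotency of the quotient is encoded by requiring that `L`
contains all commutators of elements of coprime orders. -/
structure IsAgrawalSubgroup {G : Type*} [Group G] (L : Subgroup G) : Prop where
  coprime_card_index : (Nat.card L).Coprime L.index
  isMulCommutative : IsMulCommutative L
  powerNormalizer_eq_top : powerNormalizer L = ⊤
  commutatorElement_mem : ∀ x y : G, (orderOf x).Coprime (orderOf y) → ⁅x, y⁆ ∈ L

theorem commutatorElement_mem_of_coprime_card {G : Type*} [Group G] {H L : Subgroup G} [L.Normal]
    (hHL : (H ⊓ L).Normal) (hLH : L ≤ normalizer (H : Set G)) {x y : G} (hy : y ∈ H)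
    (hyL : (orderOf y).Coprime (Nat.card L)) (hxy : ⁅x, y⁆ ∈ L) : ⁅x, y⁆ ∈ H := by
  have hmem : ⁅⁅x, y⁆, y⁆ ∈ H ⊓ L := by
    refine mem_inf.mpr ⟨H.mul_mem ((mem_normalizer_iff.mp (hLH hxy) y).mp hy) (H.inv_mem hy), ?_⟩
    exact commutator_le_left L ⊤ (commutator_mem_commutator hxy (mem_top y))
  have hcomm : Commute ((⁅x, y⁆ : G) : G ⧸ H ⊓ L) (y : G ⧸ H ⊓ L) :=
    commutatorElement_eq_one_iff_commute.mp ((QuotientGroup.eq_one_iff _).mpr hmem)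
  have hpow_y : (⁅x, y⁆ * y) ^ orderOf y = 1 := by
    rw [commutatorElement_def, inv_mul_cancel_right, conj_pow, pow_orderOf_eq_one, mul_one,
      mul_inv_cancel]
  have hpow_mem : ⁅x, y⁆ ^ orderOf y ∈ H ⊓ L := by
    have hquot := congrArg (QuotientGroup.mk' (H ⊓ L)) hpow_y
    rw [map_pow, map_mul, map_one] at hquot
    rw [← QuotientGroup.eq_one_iff, QuotientGroup.mk_pow, ← hquot]
    refine Eq.trans ?_ (hcomm.mul_pow _).symm
    rw [← QuotientGroup.mk_pow _ y, pow_orderOf_eq_one, QuotientGroup.mk_one, mul_one]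
  have hpow_card : ⁅x, y⁆ ^ Nat.card L = 1 :=
    orderOf_dvd_iff_pow_eq_one.mp (L.orderOf_dvd_natCard hxy)
  exact (mem_of_pow_mem_of_coprime hyL hpow_mem (hpow_card ▸ one_mem _)).1

namespace IsAgrawalSubgroup

variable {G : Type*} [Group G] {H K L : Subgroup G}

theorem normal_of_le (hL : IsAgrawalSubgroup L) (hH : H ≤ L) : H.Normal :=
  normal_of_powerNormalizer_eq_top hL.powerNormalizer_eq_top hH

theorem normal (hL : IsAgrawalSubgroup L) : L.Normal :=
  hL.normal_of_le le_rfl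

theorem conj_mem_zpowers (hL : IsAgrawalSubgroup L) (x : G) {l : G} (hl : l ∈ L) :
    x * l * x⁻¹ ∈ zpowers l :=
  conj_mem_zpowers_of_mem_powerNormalizer (hL.powerNormalizer_eq_top ▸ mem_top x) hl

theorem subgroupOf (hL : IsAgrawalSubgroup L) (K : Subgroup G) :
    IsAgrawalSubgroup (L.subgroupOf K) where
  coprime_card_index := by
    have := hL.normal
    exact (hL.coprime_card_index.coprime_dvd_left
      (card_comap_dvd_of_injective L K.subtype K.subtype_injective)).coprime_dvd_right
      (relIndex_dvd_index_of_normal L K)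
  isMulCommutative := have := hL.isMulCommutative; inferInstance
  powerNormalizer_eq_top := by
    have htop := powerNormalizer_anti (map_comap_le K.subtype L)
    rw [hL.powerNormalizer_eq_top] at htop
    exact top_le_iff.mp ((comap_top K.subtype ▸ comap_mono htop).trans
      (comap_powerNormalizer_map_le K.subtype_injective))
  commutatorElement_mem x y h := hL.commutatorElement_mem x y (by rwa [orderOf_coe, orderOf_coe])

theorem mem_of_orderOf_eq_prime_pow (hL : IsAgrawalSubgroup L) {p k : ℕ} (hpL : p ∣ Nat.card L)
    {x : G} (hx : orderOf x = p ^ k) : x ∈ L := by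
  have := hL.normal
  refine mem_of_coprime_orderOf_index ?_
  rw [hx]
  exact (hL.coprime_card_index.coprime_dvd_left hpL).pow_left k

theorem commute_of_orderOf_eq_prime_pow (hL : IsAgrawalSubgroup L) {p k : ℕ} (hpL : p ∣ Nat.card L)
    {x l : G} (hx : orderOf x = p ^ k) (hl : l ∈ L) : Commute x l :=
  have := hL.isMulCommutative
  setLike_mul_comm (s := L) (hL.mem_of_orderOf_eq_prime_pow hpL hx) hl

theorem hasLocalPowerAction (hL : IsAgrawalSubgroup L) : HasLocalPowerAction G := by
  intro p hp K hK x hx hxp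
  have := Fact.mk hp
  have := hL.normal
  rcases hK.le_or_disjoint_of_coprime hL.coprime_card_index with hKL | hdisj
  · exact powerNormalizer_anti hKL (hL.powerNormalizer_eq_top ▸ mem_top x)
  refine centralizer_le_powerNormalizer (mem_centralizer_iff.mpr fun k hk => ?_)
  have hmemL : ⁅x, k⁆ ∈ L :=
    hL.commutatorElement_mem x k (coprime_orderOf_of_mem hK
      (Nat.coprime_comm.mp hxp) hk).symm
  have hmemK : ⁅x, k⁆ ∈ K := K.mul_mem ((mem_normalizer_iff.mp hx k).mp hk) (K.inv_mem hk)
  exact (commutatorElement_eq_one_iff_mul_comm.mp (disjoint_def.mp hdisj hmemL hmemK)).symm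

theorem le_normalizer_of_isSPermutable [Finite G] (hL : IsAgrawalSubgroup L)
    (hH : H.IsSPermutable) : L ≤ normalizer (H : Set G) := by
  have := hL.normal
  refine fun l hl => mem_normalizer_of_forall_prime_pow_orderOf fun q k hq y hy hyo => ?_
  by_cases hqL : q ∣ Nat.card L
  · rwa [← (hL.commute_of_orderOf_eq_prime_pow hqL hyo hl).eq, mul_inv_cancel_right]
  have := Fact.mk hq
  obtain ⟨Q, hQ⟩ : ∃ Q : Sylow q G, l * y * l⁻¹ ∈ Q := exists_sylow_mem_of_orderOf_eq <|
    (orderOf_injective (MulAut.conj l).toMonoidHom (MulAut.conj l).injective y).trans hyo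
  obtain ⟨n, hn⟩ := IsPGroup.iff_card.mp Q.isPGroup'
  have hmem : ⁅l, y⁆ ∈ L := commutator_le_left L ⊤ (commutator_mem_commutator hl (mem_top y))
  have hzL : zpowers ⁅l, y⁆ ≤ L := zpowers_le.mpr hmem
  have := hL.normal_of_le hzL
  have hzH : zpowers ⁅l, y⁆ ≤ H := by
    refine le_of_permutesWith_of_coprime (hH q hq Q) (zpowers_le.mpr ?_) ?_
    · exact mul_mem (le_sup_right (a := H) hQ) (le_sup_left (b := (Q : Subgroup G)) (H.inv_mem hy))
    · rw [hn]
      have hcop : (Nat.card L).Coprime q := (hq.coprime_iff_not_dvd.mpr hqL).symm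
      exact (hcop.coprime_dvd_left (card_dvd_of_le hzL)).pow_right n
  have hconj : l * y * l⁻¹ = ⁅l, y⁆ * y := by rw [commutatorElement_def, inv_mul_cancel_right]
  rw [hconj]
  exact H.mul_mem (zpowers_le.mp hzH) hy

theorem sup_sylow_normal [Finite G] (hL : IsAgrawalSubgroup L) {q : ℕ} [hq : Fact q.Prime]
    (Q : Sylow q G) : ((Q : Subgroup G) ⊔ L).Normal := by
  have := hL.normal
  refine normalizer_eq_top_iff.mp (eq_top_of_sylow_le_of_forall_coprime_mem Q
    (le_sup_left.trans le_normalizer) fun z hz => ?_)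
  suffices (Q : Subgroup G) ⊔ L ≤ ((Q : Subgroup G) ⊔ L).comap (MulAut.conj z).toMonoidHom from
    mem_normalizer_fintype fun n hn => this hn
  refine sup_le (fun x hx => ?_) fun x hx =>
    le_sup_right (a := (Q : Subgroup G)) (hL.normal.conj_mem x hx z)
  have hzx : ⁅z, x⁆ ∈ L :=
    hL.commutatorElement_mem z x (coprime_orderOf_of_mem Q.isPGroup' hz.symm hx).symm
  have hconj : z * x * z⁻¹ = ⁅z, x⁆ * x := by rw [commutatorElement_def, inv_mul_cancel_right]
  rw [mem_comap]
  change z * x * z⁻¹ ∈ _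
  rw [hconj]
  exact mul_mem (le_sup_right (a := (Q : Subgroup G)) hzx) (le_sup_left (b := L) hx)

theorem exists_conj_mem_sylow [Finite G] (hL : IsAgrawalSubgroup L) {q k : ℕ} [Fact q.Prime]
    (Q : Sylow q G) {y : G} (hy : orderOf y = q ^ k) : ∃ l ∈ L, l⁻¹ * y * l ∈ Q := by
  have := hL.normal
  have := hL.sup_sylow_normal Q
  have htop : L ⊔ normalizer (Q : Set G) = ⊤ := by
    rw [eq_top_iff, ← Sylow.normalizer_sup_eq_top' Q (le_sup_left (b := L))]
    exact sup_le le_sup_right (sup_le (le_normalizer.trans le_sup_right) le_sup_left)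
  obtain ⟨R, hR⟩ := exists_sylow_mem_of_orderOf_eq hy
  obtain ⟨g, rfl⟩ := MulAction.exists_smul_eq G Q R
  obtain ⟨l, hl, n, hn, rfl⟩ := mem_sup_of_normal_left.mp (htop ▸ mem_top g)
  rw [mul_smul, Sylow.smul_eq_iff_mem_normalizer.mpr hn] at hR
  refine ⟨l, hl, ?_⟩
  have hmem := (mem_pointwise_smul_iff_inv_smul_mem (a := MulAut.conj l)
    (S := (Q : Subgroup G))).mp hR
  rwa [← map_inv, MulAut.smul_def, MulAut.conj_apply, inv_inv] at hmem

theorem mul_mem_mul_sylow_of_orderOf_eq [Finite G] (hL : IsAgrawalSubgroup L)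
    (hH : L ≤ normalizer (H : Set G)) {q k : ℕ} [Fact q.Prime] (Q : Sylow q G) {x y : G}
    (hx : x ∈ Q) (hy : y ∈ H) (hyq : orderOf y = q ^ k) :
    x * y ∈ (H : Set G) * (Q : Subgroup G) := by
  obtain ⟨l, hl, hz⟩ := hL.exists_conj_mem_sylow Q hyq
  have hzH : l⁻¹ * y * l ∈ H := (mem_normalizer_iff''.mp (hH hl) y).mp hy
  have hyz : y * (l⁻¹ * y * l)⁻¹ ∈ H ⊓ L := by
    have hconj : y * (l⁻¹ * y * l)⁻¹ = y * l⁻¹ * y⁻¹ * l := by group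
    exact mem_inf.mpr ⟨H.mul_mem hy (H.inv_mem hzH),
      hconj ▸ L.mul_mem (hL.normal.conj_mem _ (L.inv_mem hl) y) hl⟩
  refine ⟨x * (y * (l⁻¹ * y * l)⁻¹) * x⁻¹,
    ((hL.normal_of_le inf_le_right).conj_mem _ hyz x).1, x * (l⁻¹ * y * l), mul_mem hx hz, ?_⟩
  group

theorem mul_mem_mul_sylow [Finite G] (hL : IsAgrawalSubgroup L)
    (hH : L ≤ normalizer (H : Set G)) {q r k : ℕ} [hq : Fact q.Prime] (Q : Sylow q G)
    (hr : r.Prime) {x y : G} (hx : x ∈ Q) (hy : y ∈ H) (hyr : orderOf y = r ^ k) :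
    x * y ∈ (H : Set G) * (Q : Subgroup G) := by
  rcases eq_or_ne r q with rfl | hrq
  · exact hL.mul_mem_mul_sylow_of_orderOf_eq hH Q hx hy hyr
  suffices x * y * x⁻¹ ∈ H from ⟨x * y * x⁻¹, this, x, hx, inv_mul_cancel_right _ _⟩
  by_cases hrL : r ∣ Nat.card L
  · exact zpowers_le.mpr hy (hL.conj_mem_zpowers x (hL.mem_of_orderOf_eq_prime_pow hrL hyr))
  have := hL.normal
  have hyL : (orderOf y).Coprime (Nat.card L) := by
    rw [hyr]
    exact (hr.coprime_iff_not_dvd.mpr hrL).pow_left k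
  have hxy : ⁅x, y⁆ ∈ L := hL.commutatorElement_mem x y <| coprime_orderOf_of_mem Q.isPGroup'
    (hyr ▸ ((Nat.coprime_primes hq.out hr).mpr hrq.symm).pow_right k) hx
  have hconj : x * y * x⁻¹ = ⁅x, y⁆ * y := by rw [commutatorElement_def, inv_mul_cancel_right]
  rw [hconj]
  exact H.mul_mem (commutatorElement_mem_of_coprime_card (hL.normal_of_le inf_le_right)
    hH hy hyL hxy) hy

theorem isSPermutable_of_le_normalizer [Finite G] (hL : IsAgrawalSubgroup L)
    (hH : L ≤ normalizer (H : Set G)) : H.IsSPermutable := by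
  intro q hq Q
  have := Fact.mk hq
  exact permutesWith_of_forall_prime_pow_orderOf fun r k hr y hy hyr x hx =>
    hL.mul_mem_mul_sylow hH Q hr hx hy hyr

theorem mem_or_commute_of_coprime [Finite G] (hL : IsAgrawalSubgroup L)
    (hLK : L ≤ normalizer (K : Set G)) {y l : G} {p k : ℕ} (hp : p.Prime) (hl : l ∈ L)
    (hlp : orderOf l = p ^ k) (hy : y ∈ K) (hyp : (orderOf y).Coprime p) :
    l ∈ K ∨ Commute y l := by
  have := Fact.mk hp
  have hpow : y ∈ powerNormalizer (zpowers l) :=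
    powerNormalizer_anti (zpowers_le.mpr hl) (hL.powerNormalizer_eq_top ▸ mem_top y)
  rcases mem_centralizer_or_isMulCommutative_of_mem_powerNormalizer
    (isPGroup_zpowers_of_orderOf_eq hlp) hpow hyp with hcent | ⟨-, hgen⟩
  · exact .inr (mem_centralizer_iff.mp hcent l (mem_zpowers l)).symm
  · refine .inl (zpowers_le.mpr ?_ (hgen l (mem_zpowers l)))
    rw [commutatorElement_def, mul_assoc, mul_assoc, ← mul_assoc l]
    exact K.mul_mem hy ((mem_normalizer_iff.mp (hLK hl) _).mp (K.inv_mem hy))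

theorem isPSTGroup [Finite G] (hL : IsAgrawalSubgroup L) : IsPSTGroup G := by
  intro H K hHK hH hK
  have hLK := hL.le_normalizer_of_isSPermutable hK
  have hLKH := (hL.subgroupOf K).le_normalizer_of_isSPermutable hH
  refine hL.isSPermutable_of_le_normalizer (le_of_forall_prime_pow_orderOf fun p k hp l hl hlp =>
    mem_normalizer_of_forall_prime_pow_orderOf fun q j hq y hy hyq => ?_)
  by_cases hlK : l ∈ K
  · exact (mem_normalizer_iff.mp (hLKH (x := ⟨l, hlK⟩) hl) ⟨y, hHK hy⟩).mp hy
  suffices hyl : Commute y l by rwa [← hyl.eq, mul_inv_cancel_right]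
  rcases eq_or_ne q p with rfl | hqp
  · have hqL : q ∣ Nat.card L :=
      ((dvd_pow_self q k.succ_ne_zero).trans hlp.symm.dvd).trans (L.orderOf_dvd_natCard hl)
    exact hL.commute_of_orderOf_eq_prime_pow hqL hyq hl
  · exact (hL.mem_or_commute_of_coprime hLK hp hl hlp (hHK hy) (hyq ▸
      ((Nat.coprime_primes hq hp).mpr hqp).pow_left (j + 1))).resolve_left hlK

end IsAgrawalSubgroup

section Fusion

variable {G : Type*} [Group G] [Finite G] {p : ℕ} [Fact p.Prime]

/-- The elements of order prime to `p` which normalize a `p`-subgroup centralize it. By Frobenius'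
theorem this is equivalent to `p`-nilpotency of a finite group `G`. -/
def HasCentralLocalAction (p : ℕ) (G : Type*) [Group G] : Prop :=
  ∀ K : Subgroup G, IsPGroup p K → ∀ x ∈ normalizer (K : Set G),
    (orderOf x).Coprime p → x ∈ centralizer (K : Set G)

theorem lt_inf_normalizer_of_lt {D P : Subgroup G} (hP : IsPGroup p P) (h : D < P) :
    D < P ⊓ normalizer (D : Set G) := by
  have := hP.isNilpotent
  have htop : D.subgroupOf P < ⊤ := lt_top_iff_ne_top.mpr (subgroupOf_eq_top.not.mpr h.not_ge)
  obtain ⟨g, hg, hgD⟩ : ∃ g ∈ normalizer (D.subgroupOf P : Set P), g ∉ D.subgroupOf P :=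
    SetLike.exists_of_lt (Group.normalizerCondition_of_isNilpotent _ htop)
  have hgN : (g : G) ∈ normalizer (D : Set G) := by
    have hmem := le_normalizer_map P.subtype (mem_map_of_mem P.subtype hg)
    rwa [map_subgroupOf_eq_of_le h.le] at hmem
  exact SetLike.lt_iff_le_and_exists.mpr
    ⟨le_inf h.le le_normalizer, (g : G), mem_inf.mpr ⟨g.2, hgN⟩, hgD⟩

namespace HasCentralLocalAction

theorem exists_centralizer_mul (h : HasCentralLocalAction p G) {D : Subgroup G} (hD : IsPGroup p D)
    (S : Sylow p (normalizer (D : Set G))) {n : G} (hn : n ∈ normalizer (D : Set G)) :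
    ∃ c ∈ centralizer (D : Set G), ∃ s ∈ S, c * s = n := by
  let C := (centralizer (D : Set G)).subgroupOf (normalizer (D : Set G))
  have htop : C ⊔ (S : Subgroup (normalizer (D : Set G))) = ⊤ :=
    eq_top_of_sylow_le_of_forall_coprime_mem S le_sup_right fun x hx =>
      mem_sup_left (h D hD x x.2 (by rwa [orderOf_coe]))
  obtain ⟨c, hc, s, hs, hcs⟩ :=
    mem_sup_of_normal_left.mp (htop ▸ mem_top (⟨n, hn⟩ : normalizer (D : Set G)))
  exact ⟨c, hc, s, hs, congrArg Subtype.val hcs⟩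

theorem exists_le_sylow_le_smul (h : HasCentralLocalAction p G) {D A B : Subgroup G}
    (hD : IsPGroup p D) (hA : IsPGroup p A) (hB : IsPGroup p B)
    (hAD : A ≤ normalizer (D : Set G)) (hBD : B ≤ normalizer (D : Set G)) :
    ∃ (R : Sylow p G) (c : G), c ∈ centralizer (D : Set G) ∧ A ≤ R ∧ B ≤ (c • R : Sylow p G) := by
  let N := normalizer (D : Set G)
  obtain ⟨S, hS⟩ := (hA.comap_subtype (K := N)).exists_le_sylow
  obtain ⟨T, hT⟩ := (hB.comap_subtype (K := N)).exists_le_sylow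
  obtain ⟨R, hR⟩ := (S.isPGroup'.map N.subtype).exists_le_sylow
  obtain ⟨m, hm⟩ := MulAction.exists_smul_eq N S T
  obtain ⟨c, hc, s, hs, hcs⟩ := h.exists_centralizer_mul hD S m.2
  refine ⟨R, c, hc, fun a ha => hR ⟨⟨a, hAD ha⟩, hS ha, rfl⟩, fun b hb => ?_⟩
  have hbS : m⁻¹ * ⟨b, hBD hb⟩ * m ∈ S := by
    have hbT : (⟨b, hBD hb⟩ : N) ∈ T := hT hb
    rw [← hm] at hbT
    have := (mem_pointwise_smul_iff_inv_smul_mem (a := MulAut.conj m)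
      (S := (S : Subgroup N))).mp hbT
    rwa [← map_inv, MulAut.smul_def, MulAut.conj_apply, inv_inv] at this
  have hbR : c⁻¹ * b * c ∈ R := by
    have := hR (mem_map_of_mem N.subtype (mul_mem (mul_mem hs hbS) (inv_mem hs)))
    have hconj : c⁻¹ * b * c = (s : G) * ((m : G)⁻¹ * b * m) * (s : G)⁻¹ := by
      rw [← hcs]; group
    exact hconj ▸ this
  refine (mem_pointwise_smul_iff_inv_smul_mem (a := MulAut.conj c)
      (S := (R : Subgroup G))).mpr ?_
  rwa [← map_inv, MulAut.smul_def, MulAut.conj_apply, inv_inv]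

theorem exists_centralizer_smul_eq (h : HasCentralLocalAction p G) (P Q : Sylow p G) :
    ∃ c ∈ centralizer ((P ⊓ Q : Subgroup G) : Set G), c • P = Q := by
  suffices hD : ∀ (D : Subgroup G) (P Q : Sylow p G), (P ⊓ Q : Subgroup G) = D →
      ∃ c ∈ centralizer (D : Set G), c • P = Q from hD _ P Q rfl
  intro D
  induction D using WellFoundedGT.induction with | ind D ih =>
  intro P Q hD
  have hgt (P' Q' : Sylow p G) (hlt : D < (P' ⊓ Q' : Subgroup G)) :
      ∃ c ∈ centralizer (D : Set G), c • P' = Q' := by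
    obtain ⟨c, hc, hcQ⟩ := ih _ hlt P' Q' rfl
    exact ⟨c, centralizer_le hlt.le hc, hcQ⟩
  rcases (hD ▸ inf_le_left : D ≤ P).eq_or_lt with hDP | hDP
  · have hPQ : (P : Subgroup G) ≤ Q := inf_eq_left.mp (hD.trans hDP)
    exact ⟨1, one_mem _, (one_smul G P).trans (Sylow.ext (P.3 Q.2 hPQ).symm)⟩
  rcases (hD ▸ inf_le_right : D ≤ Q).eq_or_lt with hDQ | hDQ
  · have hQP : (Q : Subgroup G) ≤ P := inf_eq_right.mp (hD.trans hDQ)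
    exact ⟨1, one_mem _, (one_smul G P).trans (Sylow.ext (Q.3 P.2 hQP))⟩
  obtain ⟨R, c, hc, hR, hcR⟩ := h.exists_le_sylow_le_smul (P.isPGroup'.to_le hDP.le)
    (P.isPGroup'.to_le inf_le_left) (Q.isPGroup'.to_le inf_le_left) inf_le_right inf_le_right
  obtain ⟨x, hx, rfl⟩ := hgt P R
    ((lt_inf_normalizer_of_lt P.isPGroup' hDP).trans_le (le_inf inf_le_left hR))
  obtain ⟨y, hy, rfl⟩ := hgt (c • x • P) Q
    ((lt_inf_normalizer_of_lt Q.isPGroup' hDQ).trans_le (le_inf hcR inf_le_left))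
  exact ⟨y * (c * x), mul_mem hy (mul_mem hc hx), by rw [mul_smul, mul_smul]⟩

theorem exists_mem_conj_eq (h : HasCentralLocalAction p G) (P : Sylow p G) {x g : G} (hx : x ∈ P)
    (hg : g * x * g⁻¹ ∈ P) : ∃ u ∈ P, g * x * g⁻¹ = u * x * u⁻¹ := by
  obtain ⟨c, hc, hcP⟩ := h.exists_centralizer_smul_eq P (g⁻¹ • P)
  have hxg : x ∈ (g⁻¹ • P : Sylow p G) := by
    refine (mem_pointwise_smul_iff_inv_smul_mem (a := MulAut.conj g⁻¹)
      (S := (P : Subgroup G))).mpr ?_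
    rwa [← map_inv, inv_inv, MulAut.smul_def, MulAut.conj_apply]
  have hxc : x * c = c * x := mem_centralizer_iff.mp hc x ⟨hx, hxg⟩
  have hn : g * c ∈ normalizer (P : Set G) := by
    rw [← Sylow.smul_eq_iff_mem_normalizer, mul_smul, hcP, smul_inv_smul]
  obtain ⟨d, hd, u, hu, hdu⟩ :=
    h.exists_centralizer_mul P.isPGroup' (P.subtype le_normalizer) hn
  have huP : (u : G) ∈ P := hu
  have hdc := mem_centralizer_iff.mp hd ((u : G) * x * (u : G)⁻¹)
    (mul_mem (mul_mem huP hx) (inv_mem huP))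
  refine ⟨u, huP, ?_⟩
  calc g * x * g⁻¹ = (g * c) * x * (g * c)⁻¹ := by
        rw [mul_assoc g c x, ← hxc]; group
    _ = d * (u * x * (u : G)⁻¹) * d⁻¹ := by rw [← hdu]; group
    _ = u * x * (u : G)⁻¹ := by rw [← hdc, mul_inv_cancel_right]

theorem focalSubgroup_le (h : HasCentralLocalAction p G) (P : Sylow p G) :
    (P : Subgroup G).focalSubgroup ≤ (commutator P).map (P : Subgroup G).subtype := by
  rw [focalSubgroup_def, closure_le]
  rintro _ ⟨hmem, x, hx, u, rfl⟩
  have hu : u * x⁻¹ * u⁻¹ ∈ P := by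
    have := mul_mem (inv_mem hx) hmem
    rwa [commutatorElement_def, mul_assoc, mul_assoc, inv_mul_cancel_left, ← mul_assoc] at this
  obtain ⟨v, hv, huv⟩ := h.exists_mem_conj_eq P (inv_mem hx) hu
  have hcomm : ⁅x, u⁆ = ⁅x, v⁆ := by
    rw [commutatorElement_def, commutatorElement_def, mul_assoc, mul_assoc, ← mul_assoc u, huv]
    group
  rw [hcomm]
  exact ⟨⁅⟨x, hx⟩, ⟨v, hv⟩⁆, commutator_mem_commutator (mem_top _) (mem_top _), rfl⟩

theorem commutator_ne_top (h : HasCentralLocalAction p G) (hp : p ∣ Nat.card G) :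
    commutator G ≠ ⊤ := by
  intro htop
  let P : Sylow p G := default
  have := P.isPGroup'.isNilpotent
  have : Nontrivial P := (nontrivial_iff_ne_bot _).mpr (P.ne_bot_of_dvd_card hp)
  have hle : (P : Subgroup G) ≤ (commutator P).map (P : Subgroup G).subtype := by
    have hfocal := commutator_inf_eq_focalSubgroup P
    rw [htop, top_inf_eq] at hfocal
    exact hfocal.le.trans (h.focalSubgroup_le P)
  refine (Group.IsSolvable.commutator_lt_top_of_nontrivial P).ne (top_le_iff.mp ?_)
  rwa [← map_subtype_le_map_subtype, ← MonoidHom.range_eq_map, range_subtype]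

end HasCentralLocalAction

omit [Fact p.Prime] in
theorem commute_of_orderOf_eq_minFac {x k : G} (hk : orderOf k = (Nat.card G).minFac)
    (hp : (Nat.card G).minFac.Prime) (hx : x ∈ normalizer (zpowers k : Set G)) : Commute x k := by
  let x' : normalizer (zpowers k : Set G) := ⟨x, hx⟩
  have hdvd_totient : orderOf ((zpowers k).normalizerMonoidHom x') ∣ (Nat.card G).minFac - 1 := by
    rw [← Nat.totient_prime hp, ← hk, ← Nat.card_zpowers k, ← IsCyclic.card_mulAut]
    exact orderOf_dvd_natCard _
  have hdvd_card : orderOf ((zpowers k).normalizerMonoidHom x') ∣ Nat.card G :=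
    ((orderOf_map_dvd _ x').trans (orderOf_mk x _).dvd).trans (orderOf_dvd_natCard x)
  have hone : (zpowers k).normalizerMonoidHom x' = 1 := by
    refine orderOf_eq_one_iff.mp (Nat.eq_one_of_dvd_coprimes ?_ hdvd_card hdvd_totient)
    refine Nat.coprime_of_dvd fun r hr hrG hrp => ?_
    have := Nat.le_of_dvd (Nat.sub_pos_of_lt hp.one_lt) hrp
    have := Nat.minFac_le_of_dvd hr.two_le hrG
    have := hp.pos
    lia
  have hconj : x * k * x⁻¹ = k := congrArg ((↑) : zpowers k → G)
    (DFunLike.congr_fun hone (⟨k, mem_zpowers k⟩ : zpowers k))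
  exact mul_inv_eq_iff_eq_mul.mp hconj

namespace HasLocalPowerAction

omit [Finite G] in
theorem subgroup (h : HasLocalPowerAction G) (S : Subgroup G) : HasLocalPowerAction S := by
  intro p hp K hK x hx hxp
  refine comap_powerNormalizer_map_le S.subtype_injective (h p hp _ (hK.map S.subtype) x ?_ ?_)
  · exact le_normalizer_map S.subtype (mem_map_of_mem S.subtype hx)
  · rwa [orderOf_coe]

theorem hasCentralLocalAction (h : HasLocalPowerAction G) (hp : (Nat.card G).minFac.Prime) :
    HasCentralLocalAction (Nat.card G).minFac G := by
  have := Fact.mk hp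
  intro K hK x hx hxp
  have hxK := h _ hp K hK x hx hxp
  by_contra hxC
  obtain ⟨-, hgen⟩ :=
    (mem_centralizer_or_isMulCommutative_of_mem_powerNormalizer hK hxK hxp).resolve_left hxC
  have hK1 : Nat.card K ≠ 1 := fun hK1 => hxC (mem_centralizer_iff.mpr fun k hk => by
    rw [mem_bot.mp ((card_eq_one.mp hK1).le hk), one_mul, mul_one])
  obtain ⟨⟨k, hk⟩, hkp⟩ := exists_prime_orderOf_dvd_card' (G := K) (Nat.card G).minFac
    (hK.card_eq_or_dvd.resolve_left hK1)
  rw [orderOf_mk] at hkp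
  have hxk : Commute x k := commute_of_orderOf_eq_minFac hkp hp
    (mem_powerNormalizer.mp hxK _ (zpowers_le.mpr hk))
  have hk1 : k = 1 := by
    simpa only [commutatorElement_eq_one_iff_commute.mpr hxk, zpowers_one_eq_bot, mem_bot]
      using hgen k hk
  exact absurd (hkp.symm.trans (orderOf_eq_one_iff.mpr hk1)) hp.ne_one

theorem isSolvable (h : HasLocalPowerAction G) : Group.IsSolvable G := by
  refine Group.isSolvable_iff_commutator_lt.mpr fun S hS => ?_
  have : Nontrivial S := S.nontrivial_iff_ne_bot.mpr hS
  have hp : (Nat.card S).minFac.Prime := Nat.minFac_prime Finite.one_lt_card.ne'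
  have := Fact.mk hp
  rw [← map_subtype_commutator]
  refine lt_of_le_of_ne (map_subtype_le _) fun heq => ?_
  refine ((h.subgroup S).hasCentralLocalAction hp).commutator_ne_top (Nat.minFac_dvd _) ?_
  rwa [← map_subtype_inj, ← MonoidHom.range_eq_map, range_subtype]

end HasLocalPowerAction

end Fusion

/-- Every element of order prime to `p` induces a power automorphism on each normal `p`-subgroup. -/
def HasNormalPowerAction (G : Type*) [Group G] : Prop :=
  ∀ p : ℕ, p.Prime → ∀ K : Subgroup G, K.Normal → IsPGroup p K → ∀ x : G,
    (orderOf x).Coprime p → x ∈ powerNormalizer K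

/-- Every homomorphic image of `G` satisfies `HasNormalPowerAction`. Unlike `HasNormalPowerAction`,
this condition passes to quotients, which makes it suitable for induction. -/
def HasQuotientPowerAction (G : Type u) [Group G] : Prop :=
  ∀ (Q : Type u) [Group Q] (f : G →* Q), Function.Surjective f → HasNormalPowerAction Q

/-- `G` has a normal `p`-complement, that is, a finite group `G` is `p`-nilpotent. -/
def HasNormalPComplement (p : ℕ) (G : Type*) [Group G] : Prop :=
  ∃ M : Subgroup G, M.Normal ∧ ¬ p ∣ Nat.card M ∧ ∃ n : ℕ, M.index = p ^ n

/-- `G` has an abelian Sylow `p`-subgroup all of whose subgroups are normal in `G`. -/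
def HasPowerSylow (p : ℕ) (G : Type*) [Group G] : Prop :=
  ∃ P : Sylow p G, IsMulCommutative P ∧ powerNormalizer (P : Subgroup G) = ⊤

section CyclicNormal

variable {G : Type*} [Group G] (N : Subgroup G) [N.Normal]

theorem ker_conjNormal_eq_centralizer :
    (MulAut.conjNormal : G →* MulAut N).ker = centralizer (N : Set G) := by
  ext g
  simp only [MonoidHom.mem_ker, mem_centralizer_iff, MulEquiv.ext_iff, Subtype.ext_iff,
    MulAut.conjNormal_apply, MulAut.one_apply, Subtype.forall, SetLike.mem_coe]
  exact forall₂_congr fun n _ => mul_inv_eq_iff_eq_mul.trans eq_comm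

theorem commutatorElement_mem_centralizer_of_isCyclic [IsCyclic N] (x y : G) :
    ⁅x, y⁆ ∈ centralizer (N : Set G) := by
  rw [← ker_conjNormal_eq_centralizer, MonoidHom.mem_ker, map_commutatorElement,
    ← (IsCyclic.mulAutMulEquiv N).map_eq_one_iff, map_commutatorElement,
    commutatorElement_eq_one_iff_mul_comm, mul_comm]

theorem not_dvd_index_centralizer_of_card_eq [Finite G] {p : ℕ} (hp : p.Prime)
    (hN : Nat.card N = p) : ¬ p ∣ (centralizer (N : Set G)).index := by
  have := Fact.mk hp
  have hcyc : IsCyclic N := isCyclic_of_prime_card hN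
  have hindex : (centralizer (N : Set G)).index ∣ p - 1 := by
    rw [← ker_conjNormal_eq_centralizer, index_ker, ← Nat.totient_prime hp, ← hN,
      ← hcyc.card_mulAut]
    exact card_subgroup_dvd_card _
  exact fun hd => Nat.not_dvd_of_pos_of_lt (Nat.sub_pos_of_lt hp.one_lt)
    (Nat.sub_lt hp.pos one_pos) (hd.trans hindex)

end CyclicNormal

section NormalPComplement

variable {G : Type*} [Group G] {p : ℕ}

theorem hasNormalPComplement_of_normalizer_le_centralizer [Finite G] [Fact p.Prime]
    {P : Sylow p G} (hP : normalizer (P : Set G) ≤ centralizer (P : Set G)) :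
    HasNormalPComplement p G := by
  obtain ⟨n, hn⟩ := IsPGroup.iff_card.mp P.2
  exact ⟨_, inferInstance, MonoidHom.not_dvd_card_ker_transferSylow P hP, n,
    (MonoidHom.ker_transferSylow_isComplement' P hP).symm.index_eq_card.trans hn⟩

theorem hasNormalPComplement_of_coprime_mem_centralizer [Finite G] [hp : Fact p.Prime]
    {P : Sylow p G} (hPn : P.Normal)
    (hP : ∀ x : G, (orderOf x).Coprime p → x ∈ centralizer (P : Set G)) :
    HasNormalPComplement p G := by
  obtain ⟨A, hA⟩ := exists_right_complement'_of_coprime P.card_coprime_index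
  have hpA : ¬ p ∣ Nat.card A := hA.symm.index_eq_card ▸ P.not_dvd_index
  obtain ⟨n, hn⟩ := IsPGroup.iff_card.mp P.2
  refine ⟨A, ?_, hpA, n, hA.index_eq_card.trans hn⟩
  have hAP : A ≤ centralizer (P : Set G) := fun a ha => hP a
    ((hp.out.coprime_iff_not_dvd.mpr hpA).symm.coprime_dvd_left (A.orderOf_dvd_natCard ha))
  rw [← normalizer_eq_top_iff, ← top_le_iff, ← hA.sup_eq_top]
  exact sup_le ((le_centralizer_iff.mp hAP).trans (centralizer_le_normalizer _)) le_normalizer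

theorem exists_normal_le_of_hasNormalPComplement (hp : p.Prime) {E : Subgroup G}
    [hE : E.Normal] (h : HasNormalPComplement p E) :
    ∃ A ≤ E, A.Normal ∧ ¬ p ∣ Nat.card A ∧ ∃ n, A.relIndex E = p ^ n := by
  obtain ⟨M, hM, hpM, n, hn⟩ := h
  refine ⟨M.map E.subtype, map_subtype_le M, ⟨fun a ha g => ?_⟩, ?_, n, ?_⟩
  · have haE : g * a * g⁻¹ ∈ E := hE.conj_mem a (map_subtype_le M ha) g
    refine ⟨⟨_, haE⟩, mem_of_coprime_orderOf_index ?_, rfl⟩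
    have horder : orderOf (g * a * g⁻¹) ∣ Nat.card M := by
      rw [← MulAut.conj_apply, MulEquiv.orderOf_eq,
        ← card_map_of_injective (K := M) E.subtype_injective]
      exact (M.map E.subtype).orderOf_dvd_natCard ha
    rw [hn, orderOf_mk]
    exact ((hp.coprime_iff_not_dvd.mpr hpM).symm.coprime_dvd_left horder).pow_right n
  · rwa [card_map_of_injective E.subtype_injective]
  · rw [relIndex, subgroupOf, comap_map_eq_self_of_injective E.subtype_injective, hn]

namespace HasNormalPComplement

variable {N : Subgroup G} [N.Normal]

theorem of_quotient (hp : p.Prime) (hN : ¬ p ∣ Nat.card N)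
    (h : HasNormalPComplement p (G ⧸ N)) : HasNormalPComplement p G := by
  obtain ⟨M, hM, hpM, n, hn⟩ := h
  refine ⟨M.comap (QuotientGroup.mk' N), inferInstance, ?_, n, ?_⟩
  · rw [show Nat.card (M.comap (QuotientGroup.mk' N)) = Nat.card N * Nat.card M from
      QuotientGroup.card_preimage_mk N M]
    exact hp.not_dvd_mul hN hpM
  · rw [M.index_comap_of_surjective (QuotientGroup.mk'_surjective N), hn]

theorem isPGroup_centralizer [Finite G] (hp : p.Prime) (hN : Nat.card N = p)
    (hO : ∀ A : Subgroup G, A.Normal → ¬ p ∣ Nat.card A → A = ⊥)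
    (h : HasNormalPComplement p (G ⧸ N)) : IsPGroup p (centralizer (N : Set G)) := by
  have := Fact.mk hp
  obtain ⟨M', hM', hpM', n, hn⟩ := h
  set M := M'.comap (QuotientGroup.mk' N)
  set E := centralizer (N : Set G) ⊓ M
  have hcyc : IsCyclic N := isCyclic_of_prime_card hN
  have hNE : N ≤ E := le_inf (le_centralizer_iff_isMulCommutative.mpr inferInstance)
    ((QuotientGroup.ker_mk' N).ge.trans (ker_le_comap _ _))
  have hpNE : ¬ p ∣ N.relIndex E := fun hd => by
    rw [← QuotientGroup.ker_mk' N, relIndex_ker] at hd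
    exact hpM' (hd.trans (card_dvd_of_le ((map_mono inf_le_right).trans (map_comap_le _ _))))
  let P : Sylow p E := (IsPGroup.of_card (n := 1) (by
    rw [Nat.card_congr (subgroupOfEquivOfLe hNE).toEquiv, hN, pow_one])).toSylow hpNE
  have hP : normalizer (P : Set E) ≤ centralizer (P : Set E) := fun x _ =>
    mem_centralizer_iff.mpr fun y hy => Subtype.ext (mem_centralizer_iff.mp x.2.1 y hy)
  obtain ⟨A, -, hA, hpA, m, hm⟩ := exists_normal_le_of_hasNormalPComplement hp
    (hasNormalPComplement_of_normalizer_le_centralizer hP)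
  rw [hO A hA hpA, relIndex_bot_left] at hm
  intro c
  refine ⟨n + m, Subtype.ext ?_⟩
  have hcE : (c : G) ^ p ^ n ∈ E := by
    refine ⟨pow_mem c.2 _, ?_⟩
    rw [← hn, ← M'.index_comap_of_surjective (QuotientGroup.mk'_surjective N)]
    exact pow_index_mem M (c : G)
  rw [coe_pow, coe_one, pow_add, pow_mul, ← hm]
  exact orderOf_dvd_iff_pow_eq_one.mp (orderOf_dvd_natCard E hcE)

end HasNormalPComplement

end NormalPComplement

section NormalSubgroups

theorem inf_center_ne_bot_of_isPGroup {G : Type*} [Group G] [Finite G] {p : ℕ} [Fact p.Prime]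
    (hG : IsPGroup p G) {N : Subgroup G} [N.Normal] (hN : N ≠ ⊥) : N ⊓ center G ≠ ⊥ := by
  have hpN : p ∣ Nat.card N := (hG.to_subgroup N).card_eq_or_dvd.resolve_left (mt card_eq_one.mp hN)
  let _ : MulAction G N := MulAction.compHom N (MulAut.conjNormal : G →* MulAut N)
  obtain ⟨z, hz, hz1⟩ := hG.exists_fixed_point_of_prime_dvd_card_of_fixed_point N hpN
    (a := 1) fun g => map_one (MulAut.conjNormal g)
  have hz_center : (z : G) ∈ center G := mem_center_iff.mpr fun g =>
    mul_inv_eq_iff_eq_mul.mp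
      ((MulAut.conjNormal_apply g z).symm.trans (congrArg Subtype.val (hz g)))
  exact fun h => hz1 (Subtype.ext (mem_bot.mp (h ▸ mem_inf.mpr ⟨z.2, hz_center⟩)).symm)

theorem exists_normal_isPGroup_le {G : Type*} [Group G] [Finite G] [Group.IsSolvable G]
    (A : Subgroup G) (hA : A.Normal) (hA1 : A ≠ ⊥) :
    ∃ q : ℕ, q.Prime ∧ ∃ M ≤ A, M.Normal ∧ M ≠ ⊥ ∧ IsPGroup q M := by
  induction A using WellFoundedLT.induction with
  | ind A ih =>
  have hlt := Group.IsSolvable.commutator_lt_of_ne_bot hA1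
  by_cases hcomm : ⁅A, A⁆ = ⊥
  · obtain ⟨q, hq, hqA⟩ := Nat.exists_prime_and_dvd (mt card_eq_one.mp hA1)
    have := Fact.mk hq
    have := le_centralizer_iff_isMulCommutative.mp (commutator_eq_bot_iff_le_centralizer.mp hcomm)
    let Q : Sylow q A := default
    have : (Q : Subgroup A).Characteristic := Q.characteristic_of_normal inferInstance
    refine ⟨q, hq, (Q : Subgroup A).map A.subtype, map_subtype_le _, inferInstance, ?_, Q.2.map _⟩
    rw [ne_eq, map_eq_bot_iff_of_injective _ A.subtype_injective]
    exact Q.ne_bot_of_dvd_card hqA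
  · obtain ⟨q, hq, M, hM, hprops⟩ := ih ⁅A, A⁆ hlt inferInstance hcomm
    exact ⟨q, hq, M, hM.trans hlt.le, hprops⟩

end NormalSubgroups

section PowerSylow

variable {G : Type*} [Group G] [Finite G] {p : ℕ} [hp : Fact p.Prime]

theorem powerNormalizer_eq_top_of_sylow (P : Sylow p G) [IsMulCommutative P]
    (h : ∀ x : G, (orderOf x).Coprime p → x ∈ powerNormalizer (P : Subgroup G)) :
    powerNormalizer (P : Subgroup G) = ⊤ :=
  eq_top_of_sylow_le_of_forall_coprime_mem P
    ((le_centralizer_iff_isMulCommutative.mpr ‹_›).trans centralizer_le_powerNormalizer) h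

theorem normalizer_le_centralizer_or_exists_mem_zpowers_commutatorElement (P : Sylow p G)
    [IsMulCommutative P] (hP : normalizer (P : Set G) ≤ powerNormalizer (P : Subgroup G)) :
    normalizer (P : Set G) ≤ centralizer (P : Set G) ∨ ∃ x : G, ∀ k ∈ P, k ∈ zpowers ⁅x, k⁆ := by
  refine or_iff_not_imp_right.mpr fun hcomm => subgroupOf_eq_top.mp ?_
  refine eq_top_of_sylow_le_of_forall_coprime_mem (P.subtype le_normalizer)
    (fun x hx => le_centralizer_iff_isMulCommutative.mpr ‹_› hx) fun x hx => ?_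
  rw [← orderOf_coe] at hx
  exact (mem_centralizer_or_isMulCommutative_of_mem_powerNormalizer P.2 (hP x.2) hx).resolve_right
    fun h => hcomm ⟨x, h.2⟩

omit [Finite G] in
theorem normalizer_le_powerNormalizer_of_disjoint {N K : Subgroup G} [N.Normal]
    (hKN : Disjoint K N) (hK : powerNormalizer (K.map (QuotientGroup.mk' N)) = ⊤) :
    normalizer (K : Set G) ≤ powerNormalizer K := by
  refine fun x hx => mem_powerNormalizer.mpr fun H hHK => ?_
  have hHN : x ∈ normalizer ((H ⊔ N : Subgroup G) : Set G) := by
    have := normal_of_powerNormalizer_eq_top hK (map_mono hHK)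
    rw [← QuotientGroup.ker_mk' N, ← comap_map_eq, normalizer_eq_top_iff.mpr inferInstance]
    exact mem_top x
  have hH : (H ⊔ N) ⊓ K = H := by
    rw [← SetLike.coe_set_eq, coe_inf, mul_normal, ← mul_inf_assoc H N K hHK, hKN.symm.eq_bot,
      coe_bot, Set.singleton_one, mul_one]
  exact hH ▸ inf_normalizer_le_normalizer_inf ⟨hHN, hx⟩

theorem normal_sylow_of_le_centralizer {N : Subgroup G} [N.Normal] (P : Sylow p G)
    (hPN : P ≤ centralizer (N : Set G))
    (hP : ((P : Subgroup G).map (QuotientGroup.mk' N)).Normal) : (P : Subgroup G).Normal := by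
  have hsup : ((P : Subgroup G) ⊔ N).Normal := by
    rw [← QuotientGroup.ker_mk' N, ← comap_map_eq]
    infer_instance
  have hN : N ≤ normalizer (P : Set G) :=
    (le_centralizer_iff.mp hPN).trans (centralizer_le_normalizer _)
  refine normalizer_eq_top_iff.mp (top_le_iff.mp ?_)
  rw [← Sylow.normalizer_sup_eq_top' P (le_sup_left (b := N))]
  exact sup_le le_rfl (sup_le le_normalizer hN)

omit [Finite G] in
theorem isMulCommutative_of_disjoint {N K : Subgroup G} [N.Normal] (hKN : Disjoint K N)
    (hK : IsMulCommutative (K.map (QuotientGroup.mk' N))) : IsMulCommutative K := by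
  refine le_centralizer_iff_isMulCommutative.mp (commutator_eq_bot_iff_le_centralizer.mp ?_)
  refine le_bot_iff.mp (hKN (commutator_le_self K) ?_)
  rw [← QuotientGroup.ker_mk' N, ← Subgroup.map_eq_bot_iff, map_commutator]
  exact commutator_eq_bot_iff_le_centralizer.mpr (le_centralizer_iff_isMulCommutative.mpr hK)

theorem HasPowerSylow.of_quotient {N : Subgroup G} [N.Normal] [IsCyclic N]
    (hN : ¬ p ∣ Nat.card N) (h : HasPowerSylow p (G ⧸ N)) :
    HasNormalPComplement p G ∨ HasPowerSylow p G := by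
  obtain ⟨P', hP'comm, hP'⟩ := h
  obtain ⟨P, rfl⟩ := Sylow.mapSurjective_surjective (QuotientGroup.mk'_surjective N) p P'
  obtain ⟨n, hn⟩ := IsPGroup.iff_card.mp P.2
  have hPN : Disjoint (P : Subgroup G) N :=
    disjoint_of_coprime_natCard (hn ▸ (hp.out.coprime_iff_not_dvd.mpr hN).pow_left n)
  have hPcomm : IsMulCommutative P := isMulCommutative_of_disjoint hPN hP'comm
  have hPpower := normalizer_le_powerNormalizer_of_disjoint hPN hP'
  refine (normalizer_le_centralizer_or_exists_mem_zpowers_commutatorElement P hPpower).imp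
    hasNormalPComplement_of_normalizer_le_centralizer fun ⟨x, hx⟩ => ⟨P, hPcomm, ?_⟩
  have hPN_comm : P ≤ centralizer (N : Set G) := fun k hk =>
    zpowers_le.mpr (commutatorElement_mem_centralizer_of_isCyclic N x k) (hx k hk)
  have hPnormal := normal_sylow_of_le_centralizer P hPN_comm
    (normal_of_powerNormalizer_eq_top hP' le_rfl)
  exact top_le_iff.mp ((normalizer_eq_top_iff.mpr hPnormal).ge.trans hPpower)

theorem exists_normal_sylow_of_quotient {N : Subgroup G} [N.Normal] (hN : Nat.card N = p)
    (hO : ∀ A : Subgroup G, A.Normal → ¬ p ∣ Nat.card A → A = ⊥)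
    (h : HasNormalPComplement p (G ⧸ N) ∨ HasPowerSylow p (G ⧸ N)) :
    ∃ P : Sylow p G, (P : Subgroup G).Normal := by
  obtain hcomp | ⟨P', -, hP'⟩ := h
  · have hC : (centralizer (N : Set G)).Normal := inferInstance
    exact ⟨(hcomp.isPGroup_centralizer hp.out hN hO).toSylow
      (not_dvd_index_centralizer_of_card_eq N hp.out hN), hC⟩
  · have hP'n : (P' : Subgroup (G ⧸ N)).Normal := normal_of_powerNormalizer_eq_top hP' le_rfl
    have hcomap : ((P' : Subgroup (G ⧸ N)).comap (QuotientGroup.mk' N)).Normal := inferInstance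
    refine ⟨(P'.2.comap_of_ker_isPGroup (QuotientGroup.mk' N) ?_).toSylow ?_, hcomap⟩
    · rw [QuotientGroup.ker_mk']
      exact IsPGroup.of_card (n := 1) (by rw [hN, pow_one])
    · rw [index_comap_of_surjective _ (QuotientGroup.mk'_surjective N)]
      exact P'.not_dvd_index

end PowerSylow

namespace HasNormalPowerAction

variable {G : Type*} [Group G] [Finite G]

theorem exists_normal_card_eq (h : HasNormalPowerAction G) {q : ℕ} [hq : Fact q.Prime]
    {M : Subgroup G} [hMn : M.Normal] (hM : IsPGroup q M) (hM1 : M ≠ ⊥) :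
    ∃ N ≤ M, N.Normal ∧ Nat.card N = q := by
  let S : Sylow q G := default
  have hMS : M ≤ S := hM.le_sylow_of_normal S
  have hZ : M.subgroupOf S ⊓ center S ≠ ⊥ := inf_center_ne_bot_of_isPGroup S.2
    (mt subgroupOf_eq_bot.mp fun h => hM1 (disjoint_self.mp (h.mono_right hMS)))
  obtain ⟨⟨z, hzM, hzS⟩, hz⟩ := exists_prime_orderOf_dvd_card' q
    ((S.2.to_subgroup _).card_eq_or_dvd.resolve_left (mt card_eq_one.mp hZ))
  have hz : orderOf (z : G) = q := by rw [orderOf_coe]; exact (orderOf_coe _).trans hz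
  refine ⟨zpowers (z : G), zpowers_le.mpr hzM, ?_, by rw [Nat.card_zpowers, hz]⟩
  rw [← normalizer_eq_top_iff]
  refine eq_top_of_sylow_le_of_forall_coprime_mem S (fun s hs => ?_) fun x hx =>
    mem_powerNormalizer.mp (h q hq.out M hMn hM x hx) _ (zpowers_le.mpr hzM)
  refine centralizer_le_normalizer _ ?_
  rw [zpowers_eq_closure, centralizer_closure, mem_centralizer_singleton_iff]
  exact congrArg Subtype.val (mem_center_iff.mp hzS ⟨s, hs⟩)

theorem exists_normal_prime_card [Group.IsSolvable G] (h : HasNormalPowerAction G)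
    (A : Subgroup G) [A.Normal] (hA : A ≠ ⊥) :
    ∃ N ≤ A, N.Normal ∧ (Nat.card N).Prime := by
  obtain ⟨q, hq, M, hMA, hMn, hM1, hM⟩ := exists_normal_isPGroup_le A ‹_› hA
  have := Fact.mk hq
  obtain ⟨N, hNM, hNn, hN⟩ := h.exists_normal_card_eq hM hM1
  exact ⟨N, hNM.trans hMA, hNn, hN ▸ hq⟩

theorem hasNormalPComplement_or_hasPowerSylow (h : HasNormalPowerAction G) {p : ℕ}
    [hp : Fact p.Prime] {P : Sylow p G} (hPn : P.Normal) :
    HasNormalPComplement p G ∨ HasPowerSylow p G := by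
  refine or_iff_not_imp_left.mpr fun hcomp => ?_
  obtain ⟨x, hx, hxP⟩ : ∃ x : G, (orderOf x).Coprime p ∧ x ∉ centralizer (P : Set G) := by
    by_contra! hcon
    exact hcomp (hasNormalPComplement_of_coprime_mem_centralizer hPn hcon)
  have hpower := h p hp.out P hPn P.2
  have hcomm : IsMulCommutative P :=
    ((mem_centralizer_or_isMulCommutative_of_mem_powerNormalizer P.2 (hpower x hx)
      hx).resolve_left hxP).1
  exact ⟨P, hcomm, powerNormalizer_eq_top_of_sylow P hpower⟩

end HasNormalPowerAction

namespace HasQuotientPowerAction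

variable {G : Type u} [Group G]

theorem of_surjective {G' : Type u} [Group G'] (h : HasQuotientPowerAction G) (f : G →* G')
    (hf : Function.Surjective f) : HasQuotientPowerAction G' :=
  fun G'' _ g hg => h G'' (g.comp f) (hg.comp hf)

theorem hasNormalPowerAction (h : HasQuotientPowerAction G) : HasNormalPowerAction G :=
  h G (MonoidHom.id G) Function.surjective_id

theorem hasNormalPComplement_or_hasPowerSylow [Finite G] [hsol : Group.IsSolvable G]
    (h : HasQuotientPowerAction G) (p : ℕ) [hp : Fact p.Prime] :
    HasNormalPComplement p G ∨ HasPowerSylow p G := by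
  induction hn : Nat.card G using Nat.strong_induction_on generalizing G with
  | _ n ih =>
  have hquot (N : Subgroup G) [N.Normal] (hN : (Nat.card N).Prime) :
      HasNormalPComplement p (G ⧸ N) ∨ HasPowerSylow p (G ⧸ N) := by
    refine ih _ ?_ (h.of_surjective _ (QuotientGroup.mk'_surjective N)) rfl
    rw [← hn, ← N.index_mul_card]
    exact lt_mul_of_one_lt_right Nat.card_pos hN.one_lt
  by_cases hO : ∀ A : Subgroup G, A.Normal → ¬ p ∣ Nat.card A → A = ⊥
  · cases subsingleton_or_nontrivial G
    · exact Or.inl ⟨⊤, inferInstance, by simp [hp.out.ne_one], 0, by simp⟩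
    obtain ⟨N, -, hNn, hNp⟩ := h.hasNormalPowerAction.exists_normal_prime_card ⊤ top_ne_bot
    have hN : Nat.card N = p := by
      by_contra hne
      refine hNp.ne_one (card_eq_one.mpr (hO N hNn fun hd => hne ?_))
      exact ((Nat.prime_dvd_prime_iff_eq hp.out hNp).mp hd).symm
    obtain ⟨P, hP⟩ := exists_normal_sylow_of_quotient hN hO (hquot N hNp)
    exact h.hasNormalPowerAction.hasNormalPComplement_or_hasPowerSylow hP
  · push Not at hO
    obtain ⟨A, hA, hpA, hA1⟩ := hO
    obtain ⟨N, hNA, hNn, hNp⟩ := h.hasNormalPowerAction.exists_normal_prime_card A hA1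
    have hN : ¬ p ∣ Nat.card N := fun hd => hpA (hd.trans (card_dvd_of_le hNA))
    have := Fact.mk hNp
    have : IsCyclic N := isCyclic_of_prime_card rfl
    exact (hquot N hNp).elim (fun hcomp => Or.inl (hcomp.of_quotient hp.out hN))
      (HasPowerSylow.of_quotient hN)

end HasQuotientPowerAction

section HallSubgroup

variable {G : Type*} [Group G] {L M : Subgroup G}

theorem commutatorElement_mem_of_index_eq_prime_pow [M.Normal] {p n : ℕ} (hp : p.Prime)
    (hM : M.index = p ^ n) {x y : G} (hxy : (orderOf x).Coprime (orderOf y)) : ⁅x, y⁆ ∈ M := by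
  have hmem : ∀ z : G, ¬ p ∣ orderOf z → z ∈ M := fun z hz => mem_of_coprime_orderOf_index
    (hM ▸ ((hp.coprime_iff_not_dvd.mpr hz).pow_left n).symm)
  by_cases hx : p ∣ orderOf x
  · have hy : ¬ p ∣ orderOf y := fun hy => hp.ne_one (Nat.eq_one_of_dvd_coprimes hxy hx hy)
    exact commutator_le_right ⊤ M (commutator_mem_commutator (mem_top x) (hmem y hy))
  · exact commutator_le_left M ⊤ (commutator_mem_commutator (hmem x hx) (mem_top y))

theorem le_of_isPGroup_of_not_dvd_index [M.Normal] {p : ℕ} [hp : Fact p.Prime] {P : Subgroup G}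
    (hP : IsPGroup p P) (hM : ¬ p ∣ M.index) : P ≤ M := fun _ hx =>
  mem_of_coprime_orderOf_index
    (coprime_orderOf_of_mem hP (hp.out.coprime_iff_not_dvd.mpr hM) hx)

namespace HasPowerSylow

variable [Finite G] {p q j k : ℕ} {x y : G}

theorem exists_normal_sylow (h : HasPowerSylow p G) [hp : Fact p.Prime] :
    ∃ P : Sylow p G, (P : Subgroup G).Normal ∧ IsMulCommutative P ∧
      powerNormalizer (P : Subgroup G) = ⊤ ∧ ∀ (x : G) (k : ℕ), orderOf x = p ^ k → x ∈ P := by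
  obtain ⟨P, hcomm, hpow⟩ := h
  have hPn : (P : Subgroup G).Normal := normal_of_powerNormalizer_eq_top hpow le_rfl
  exact ⟨P, hPn, hcomm, hpow, fun x k hx => mem_of_coprime_orderOf_index
    (hx ▸ (hp.out.coprime_iff_not_dvd.mpr P.not_dvd_index).pow_left k)⟩

theorem conj_mem_zpowers (h : HasPowerSylow p G) [Fact p.Prime] (hx : orderOf x = p ^ k) (g : G) :
    g * x * g⁻¹ ∈ zpowers x := by
  obtain ⟨P, -, -, hpow, hP⟩ := h.exists_normal_sylow
  exact conj_mem_zpowers_of_mem_powerNormalizer (hpow ▸ mem_top g) (hP x k hx)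

theorem commute (h : HasPowerSylow p G) [Fact p.Prime] (h' : HasPowerSylow q G) [Fact q.Prime]
    (hx : orderOf x = p ^ j) (hy : orderOf y = q ^ k) : Commute x y := by
  obtain ⟨P, hPn, hcomm, -, hP⟩ := h.exists_normal_sylow
  obtain ⟨Q, hQn, -, -, hQ⟩ := h'.exists_normal_sylow
  rcases eq_or_ne p q with rfl | hpq
  · exact setLike_mul_comm (s := (P : Subgroup G)) (hP x j hx) (hP y k hy)
  · exact commute_of_normal_of_disjoint _ _ hPn hQn
      (IsPGroup.disjoint_of_ne p q hpq _ _ P.2 Q.2) x y (hP x j hx) (hQ y k hy)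

end HasPowerSylow

section ForallPrime

variable [Finite G] (hL : ∀ p : ℕ, p.Prime → p ∣ Nat.card L → HasPowerSylow p G)
include hL

omit [Finite G] in
theorem hasPowerSylow_of_mem {p k : ℕ} (hp : p.Prime) {x : G} (hx : x ∈ L)
    (hxp : orderOf x = p ^ (k + 1)) : HasPowerSylow p G :=
  hL p hp (((dvd_pow_self p k.succ_ne_zero).trans hxp.symm.dvd).trans (L.orderOf_dvd_natCard hx))

theorem isMulCommutative_of_forall_hasPowerSylow : IsMulCommutative L := by
  refine le_centralizer_iff_isMulCommutative.mp (le_of_forall_prime_pow_orderOf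
    fun p j hp x hx hxp => ?_)
  have := Fact.mk hp
  suffices L ≤ centralizer {x} from
    mem_centralizer_iff.mpr fun y hy => mem_centralizer_singleton_iff.mp (this hy)
  refine le_of_forall_prime_pow_orderOf fun q k hq y hy hyq => ?_
  have := Fact.mk hq
  exact mem_centralizer_singleton_iff.mpr
    ((hasPowerSylow_of_mem hL hq hy hyq).commute (hasPowerSylow_of_mem hL hp hx hxp) hyq hxp)

theorem powerNormalizer_eq_top_of_forall_hasPowerSylow : powerNormalizer L = ⊤ := by
  refine eq_top_iff.mpr fun x _ => mem_powerNormalizer.mpr fun H hHL =>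
    mem_normalizer_of_forall_prime_pow_orderOf fun p k hp y hy hyp => zpowers_le.mpr hy ?_
  have := Fact.mk hp
  exact (hasPowerSylow_of_mem hL hp (hHL hy) hyp).conj_mem_zpowers hyp x

end ForallPrime

theorem HasQuotientPowerAction.exists_isAgrawalSubgroup {G : Type u} [Group G] [Finite G]
    [Group.IsSolvable G] (h : HasQuotientPowerAction G) :
    ∃ L : Subgroup G, IsAgrawalSubgroup L := by
  have hcompl : ∀ p : {p : ℕ // p.Prime ∧ ¬ HasPowerSylow p G}, HasNormalPComplement p G :=
    fun p =>
      have := Fact.mk p.2.1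
      (h.hasNormalPComplement_or_hasPowerSylow p.1).resolve_right p.2.2
  choose M hMn hMp n hMi using hcompl
  have hpow : ∀ r : ℕ, r.Prime → r ∣ Nat.card (⨅ p, M p : Subgroup G) → HasPowerSylow r G :=
    fun r hr hrL => by
      by_contra hrG
      exact hMp ⟨r, hr, hrG⟩ (hrL.trans (card_dvd_of_le (iInf_le M _)))
  refine ⟨⨅ p, M p, ?_, isMulCommutative_of_forall_hasPowerSylow hpow,
    powerNormalizer_eq_top_of_forall_hasPowerSylow hpow, fun x y hxy => mem_iInf.mpr fun p =>
      commutatorElement_mem_of_index_eq_prime_pow p.2.1 (hMi p) hxy⟩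
  refine Nat.coprime_of_dvd fun r hr hrL hri => ?_
  have := Fact.mk hr
  obtain ⟨P, -⟩ := hpow r hr hrL
  refine P.not_dvd_index (hri.trans (index_dvd_of_le (le_iInf fun p =>
    le_of_isPGroup_of_not_dvd_index P.2 fun hd => p.2.2 ?_)))
  rw [hMi] at hd
  exact (Nat.prime_dvd_prime_iff_eq hr p.2.1).mp (hr.dvd_of_dvd_pow hd) ▸ hpow r hr hrL

end HallSubgroup

section Quotient

variable {G G' : Type*} [Group G] [Group G'] [Finite G] {f : G →* G'} {p : ℕ}

theorem exists_mem_zpowers_map_eq_and_coprime (hp : p.Prime) {x : G}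
    (hx : (orderOf (f x)).Coprime p) : ∃ y ∈ zpowers x, f y = f x ∧ (orderOf y).Coprime p := by
  obtain ⟨a, b, hb, hab⟩ := Nat.exists_eq_pow_mul_and_not_dvd (orderOf_pos x).ne' p hp.ne_one
  obtain ⟨j, hj_one, hj_zero⟩ := Nat.chineseRemainder (hx.pow_right a) 1 0
  refine ⟨x ^ j, pow_mem (mem_zpowers x) j, ?_, ?_⟩
  · rw [map_pow, pow_eq_pow_iff_modEq.mpr hj_one, pow_one]
  · refine Nat.Coprime.coprime_dvd_left (orderOf_dvd_of_pow_eq_one (n := b) ?_)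
      (hp.coprime_iff_not_dvd.mpr hb).symm
    rw [← pow_mul, ← orderOf_dvd_iff_pow_eq_one, hab]
    exact mul_dvd_mul_right (Nat.modEq_zero_iff_dvd.mp hj_zero) b

theorem exists_isPGroup_map_eq_and_map_normalizer_eq_top (hf : Function.Surjective f)
    [hp : Fact p.Prime] {K : Subgroup G'} [K.Normal] (hK : IsPGroup p K) :
    ∃ S : Subgroup G, IsPGroup p S ∧ S.map f = K ∧ (normalizer (S : Set G)).map f = ⊤ := by
  let S : Sylow p (K.comap f) := default
  have hSK : ((S : Subgroup (K.comap f)).map (K.comap f).subtype).map f = K := by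
    have hsurj := f.subgroupComap_surjective_of_surjective K hf
    have htop : (S : Subgroup (K.comap f)).map (f.subgroupComap K) = ⊤ :=
      ((S.mapSurjective hsurj).3 (hK.to_subgroup ⊤) le_top).symm
    calc _ = ((S : Subgroup (K.comap f)).map (f.subgroupComap K)).map K.subtype := by
          rw [map_map, map_map]
          rfl
      _ = K := by rw [htop, ← MonoidHom.range_eq_map, range_subtype]
  refine ⟨_, S.2.map _, hSK, ?_⟩
  have htop := congrArg (Subgroup.map f) (Sylow.normalizer_sup_eq_top S)
  have hKN : K ≤ (normalizer (((S : Subgroup (K.comap f)).map (K.comap f).subtype :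
      Subgroup G) : Set G)).map f := hSK.symm.le.trans (map_mono le_normalizer)
  rwa [Subgroup.map_sup, map_comap_eq_self_of_surjective hf, sup_eq_left.mpr hKN,
    map_top_of_surjective f hf] at htop

end Quotient

/-- Frattini's argument lifts a normal `p`-subgroup of the image, together with an element of order
prime to `p`, to a `p`-subgroup and an element normalizing it. -/
theorem HasLocalPowerAction.hasQuotientPowerAction {G : Type u} [Group G] [Finite G]
    (h : HasLocalPowerAction G) : HasQuotientPowerAction G := by
  intro Q _ f hf p hp K hKn hK x hx
  have := Fact.mk hp
  obtain ⟨S, hS, rfl, htop⟩ := exists_isPGroup_map_eq_and_map_normalizer_eq_top hf hK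
  obtain ⟨n, hn, rfl⟩ := htop.symm.le (mem_top x)
  obtain ⟨y, hy, hyn, hyp⟩ := exists_mem_zpowers_map_eq_and_coprime hp hx
  rw [← hyn]
  exact map_powerNormalizer_le f
    (mem_map_of_mem f (h p hp S hS y (zpowers_le.mpr hn hy) hyp))

theorem isSubnormal_of_isNilpotent {G : Type*} [Group G] [Finite G] [Group.IsNilpotent G]
    (H : Subgroup G) : H.IsSubnormal := by
  induction H using WellFoundedGT.induction with
  | _ H ih =>
    rcases eq_top_or_lt_top H with rfl | hH
    · exact .top
    · exact .step H _ le_normalizer (ih _ (Group.normalizerCondition_of_isNilpotent H hH))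
        inferInstance

theorem isSPermutable_of_normal {G : Type*} [Group G] (N : Subgroup G) [N.Normal] :
    N.IsSPermutable := fun _ _ _ => permutesWith_of_le_normalizer le_normalizer_of_normal

theorem IsPSTGroup.isSPermutable_of_isSubnormal {G : Type*} [Group G] (hG : IsPSTGroup G)
    {H : Subgroup G} (hH : H.IsSubnormal) : H.IsSPermutable := by
  induction hH with
  | top => exact isSPermutable_of_normal ⊤
  | step H K hHK _ _ hK => exact hG H K hHK (isSPermutable_of_normal _) hK

/-- Subgroups of a normal `p`-subgroup are subnormal, hence have S-permutable preimages. -/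
theorem IsPSTGroup.hasQuotientPowerAction {G : Type u} [Group G] [Finite G] (hG : IsPSTGroup G) :
    HasQuotientPowerAction G := by
  intro Q _ f hf p hp K hKn hK x hx
  have := Fact.mk hp
  have : Finite Q := Finite.of_surjective f hf
  refine mem_powerNormalizer.mpr fun H hHK =>
    mem_of_coprime_of_forall_prime_pow_orderOf hx fun q k hq hqp y _ hy => ?_
  have := Fact.mk hq
  have := hK.isNilpotent
  have hH : H.IsSubnormal := (isSubnormal_of_isNilpotent (H.subgroupOf K)).trans hHK hKn.isSubnormal
  obtain ⟨R, hyR⟩ := exists_sylow_mem_of_orderOf_eq hy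
  obtain ⟨R, rfl⟩ := Sylow.mapSurjective_surjective hf q R
  have hperm := permutesWith_map f (hG.isSPermutable_of_isSubnormal (hH.comap f) q hq R)
  rw [map_comap_eq_self_of_surjective hf] at hperm
  exact le_normalizer_of_permutesWith (IsPGroup.disjoint_of_ne p q hqp.symm _ _ hK (R.2.map f))
    le_normalizer_of_normal hHK hperm hyR

section Normalizer

variable {G : Type*} [Group G]

theorem hasLocalPowerAction_of_isSSPermutable [Finite G]
    (h : ∀ p : ℕ, p.Prime → p ∣ Nat.card G → ∀ H K : Subgroup G, IsPGroup p H → IsPGroup p K →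
      H ≤ K → (H.subgroupOf (normalizer (K : Set G))).IsSSPermutable) :
    HasLocalPowerAction G := by
  intro p hp K hK x hxK hx
  have := Fact.mk hp
  refine mem_powerNormalizer.mpr fun H hHK => ?_
  rcases hK.card_eq_or_dvd with hcard | hdvd
  · rw [le_bot_iff.mp (hHK.trans_eq (card_eq_one.mp hcard)), normalizer_eq_top]
    exact mem_top x
  have hss := h p hp (hdvd.trans K.card_subgroup_dvd_card) H K (hK.to_le hHK) hK hHK
  have hmem := mem_normalizer_of_isSSPermutable (H := H.subgroupOf (normalizer (K : Set G)))
    (K := K.subgroupOf _) hK.comap_subtype (comap_mono hHK) hss (x := ⟨x, hxK⟩)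
    (by rwa [orderOf_mk])
  have hmap := le_normalizer_map (normalizer (K : Set G)).subtype (mem_map_of_mem _ hmem)
  rwa [map_subgroupOf_eq_of_le (hHK.trans le_normalizer)] at hmap

theorem HasLocalPowerAction.isNSSPermutable (h : HasLocalPowerAction G) {p : ℕ} (hp : p.Prime)
    {H K : Subgroup G} (hK : IsPGroup p K) (hHK : H ≤ K) :
    (H.subgroupOf (normalizer (K : Set G))).IsNSSPermutable := by
  have := Fact.mk hp
  refine isNSSPermutable_of_forall_mem_normalizer (K := K.subgroupOf (normalizer (K : Set G)))
    hK.comap_subtype (comap_mono hHK) fun x hx => ?_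
  rw [← orderOf_coe] at hx
  exact le_normalizer_comap _ (mem_powerNormalizer.mp (h p hp K hK x x.2 hx) H hHK)

end Normalizer

theorem theoremC (G : Type*) [Group G] [Finite G] :
    List.TFAE [
      ∀ p : ℕ, p.Prime → p ∣ Nat.card G → ∀ H K : Subgroup G, IsPGroup p H → IsPGroup p K →
        H ≤ K → (H.subgroupOf (Subgroup.normalizer (K : Set G))).IsSSPermutable,
      ∀ p : ℕ, p.Prime → p ∣ Nat.card G → ∀ H K : Subgroup G, IsPGroup p H → IsPGroup p K →
        H ≤ K → (H.subgroupOf (Subgroup.normalizer (K : Set G))).IsNSSPermutable,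
      Group.IsSolvable G ∧ IsPSTGroup G] := by
  tfae_have 2 → 1 := fun h p hp hpG H K hH hK hHK =>
    isSSPermutable_of_isNSSPermutable (h p hp hpG H K hH hK hHK)
  tfae_have 1 → 3 := by
    intro h
    have hlocal := hasLocalPowerAction_of_isSSPermutable h
    have hsolvable := hlocal.isSolvable
    obtain ⟨L, hL⟩ := hlocal.hasQuotientPowerAction.exists_isAgrawalSubgroup
    exact ⟨hsolvable, hL.isPSTGroup⟩
  tfae_have 3 → 2 := by
    rintro ⟨hsolvable, hPST⟩ p hp - H K - hK hHK
    obtain ⟨L, hL⟩ := hPST.hasQuotientPowerAction.exists_isAgrawalSubgroup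
    exact hL.hasLocalPowerAction.isNSSPermutable hp hK hHK
  tfae_finish
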